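/- Let $\alpha\ge 1$ and let $n_1,\dots,n_\alpha\ge 3$ be integers. Let $\Sigma=\{\sigma_1,\dots,\sigma_{\alpha+1}\}$ be an alphabet of $\alpha+1$ letters. For $1\le k\le\alpha$ let $A_k$ be the complete DFA over $\Sigma$ with state set $Q_k=\{0,\dots,n_k-1\}$, initial state $0$ and unique final state $n_k-1$, in which $\sigma_{k-1}$ (if $k\ge 2$) acts as the contraction sending $1$ to $0$ and fixing all other states, $\sigma_k$ acts as the transposition $(0,1)$, $\sigma_{k+1}$ acts as the cycle $(0,1,\dots,n_k-1)$, and every other letter acts as the identity. The state complexity $\mathrm{sc}(L)$ of a regular language $L$ is the number of states of its minimal complete DFA. A sequence $(S_1,\dots,S_\alpha)$ with $S_k\subseteq Q_k$ is called valid if $S_1$ is a singleton and, for all $1\le k<\alpha$, $S_k=\emptyset$ implies $S_{k+1}=\emptyset$, and $n_k-1\in S_k$ implies $0\in S_{k+1}$. Theorem. Every $A_k$ is a minimal DFA (so $\mathrm{sc}(L(A_k))=n_k$), and $(L(A_1),\dots,L(A_\alpha))$ is a witness for the catenation of $\alpha$ languages, that is, $$\mathrm{sc}\bigl(L(A_1)L(A_2)\cdots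 L(A_\alpha)\bigr)=\max\bigl\{\mathrm{sc}(K_1K_2\cdots K_\alpha)\bigr\},$$ where the maximum is over all finite alphabets and all $\alpha$-tuples of regular languages $K_1,\dots,K_\alpha$ over a common such alphabet with $\mathrm{sc}(K_k)=n_k$ for all $k$. Moreover, $\mathrm{sc}(L(A_1)L(A_2)\cdots L(A_\alpha))$ equals the number of valid sequences. -/

import Mathlib

namespace MultiCatenation

/-- The state complexity of a regular language: the least number of states of a complete
deterministic finite automaton recognizing it. -/
noncomputable def stateComplexity {Γ : Type*} (L : Language Γ) : ℕ :=
  sInf {m : ℕ | ∃ M : DFA Γ (Fin m), M.accepts = L}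

/-- A DFA with `m` states is minimal if no equivalent DFA has fewer states. -/
def IsMinimalDFA {Γ : Type*} {m : ℕ} (M : DFA Γ (Fin m)) : Prop :=
  ∀ (m' : ℕ) (M' : DFA Γ (Fin m')), M'.accepts = M.accepts → m ≤ m'

/-- The catenation `L₁ · L₂ ⋯ L_α`, in this order. -/
def catenation {Γ : Type*} {α : ℕ} (L : Fin α → Language Γ) : Language Γ :=
  (List.ofFn L).prod

/-- The state complexities of all catenations of `α` regular languages over a common finite
alphabet whose state complexities are `n₁, …, n_α`. The state complexity of the `α`-ary
catenation at `(n₁, …, n_α)` is the maximum of this set. -/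
def catenationComplexities {α : ℕ} (n : Fin α → ℕ) : Set ℕ :=
  {c | ∃ (Γ : Type) (_ : Finite Γ) (K : Fin α → Language Γ),
    (∀ k, (K k).IsRegular ∧ stateComplexity (K k) = n k) ∧ stateComplexity (catenation K) = c}

/-- `(L₁, …, L_α)` is a witness for catenation at `(n₁, …, n_α)`: each `L_k` is a regular language
of state complexity `n_k`, and the state complexity of `L₁ ⋯ L_α` is the maximal possible one. -/
def IsCatenationWitness {Γ : Type*} {α : ℕ} (n : Fin α → ℕ) (L : Fin α → Language Γ) : Prop :=
  (∀ k, (L k).IsRegular ∧ stateComplexity (L k) = n k) ∧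
    IsGreatest (catenationComplexities n) (stateComplexity (catenation L))

/-- Valid sequences `(S₁, …, S_α)` of subsets of the state sets of `A₁, …, A_α`. -/
structure IsValid {Γ : Type*} {α : ℕ} {Q : Fin α → Type*} (A : (k : Fin α) → DFA Γ (Q k))
    (S : (k : Fin α) → Set (Q k)) : Prop where
  /-- `S₁` is a singleton. -/
  singleton : ∀ k : Fin α, (k : ℕ) = 0 → ∃ q, S k = {q}
  /-- If `S_k` is empty, so is `S_{k+1}`. -/
  empty : ∀ j k : Fin α, (k : ℕ) = j + 1 → S j = ∅ → S k = ∅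
  /-- If `S_k` contains a final state, then `S_{k+1}` contains the initial state. -/
  final : ∀ j k : Fin α, (k : ℕ) = j + 1 → (S j ∩ (A j).accept).Nonempty → (A k).start ∈ S k

/-- The cycle `(0, 1, …, m - 1)`. -/
def cycle (m : ℕ) : Fin m → Fin m := finRotate m

/-- The transposition `(0, 1)`. -/
def transposition (m : ℕ) (hm : 2 ≤ m) : Fin m → Fin m :=
  Equiv.swap ⟨0, by omega⟩ ⟨1, by omega⟩

/-- The contraction that sends `1` to `0` and fixes all other states. -/
def contraction (m : ℕ) (hm : 2 ≤ m) : Fin m → Fin m :=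
  Function.update id ⟨1, by omega⟩ ⟨0, by omega⟩

/-- The automaton `A_{k+1}` with `m` states, over the alphabet `σ₁, …, σ_{α+1}`. Both automata and
letters are numbered from `0` here: `a : Fin (α + 1)` is the letter `σ_{a+1}`. The letter preceding
`σ_{k+1}` (if any) acts as the contraction, `σ_{k+1}` as the transposition, `σ_{k+2}` as the cycle
and all other letters as the identity. -/
def witnessDFA {α : ℕ} (k : Fin α) (m : ℕ) (hm : 2 ≤ m) : DFA (Fin (α + 1)) (Fin m) where
  step q a :=
    if (a : ℕ) + 1 = k then contraction m hm q
    else if (a : ℕ) = k then transposition m hm q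
    else if (a : ℕ) = k + 1 then cycle m q
    else q
  start := ⟨0, by omega⟩
  accept := {⟨m - 1, by omega⟩}

end MultiCatenation

/-! Upper bound. For arbitrary automata `B k`, attach to a word `w` the sequence `reached B w` of
state sets of the subset construction for the catenation. It is always valid, it determines its
successor under each letter, and it decides acceptance. By Myhill–Nerode the complexity of the
catenation is at most the number of valid sequences of `B` (`stateComplexity_catenation_le`). For
given sizes and nonempty sets of final states, this number is largest when each automaton has a
single final state different from the initial one (`ncard_isValid_le`), as the witnesses do.

Lower bound. For the witnesses, all valid sequences are reachable and pairwise distinguishable.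

Reachability (`reaches_of_validSeq`) is proved backwards, by undoing letters. Undoing letter `k + 1`
turns component `k` back by one place, swaps `0` and `1` in component `k + 1`, and undoes a
contraction in component `k + 2`, where a `1` may be added beside `0`. Call a component fed if its
predecessor contains its last state; feeding inserts `0`. A simultaneous induction
(`canMakeShiftable_and_canInsertOne`) shows that earlier components can be arranged so that a given
component can be shifted down, or so that `1` can be inserted into it, without disturbing later
ones. Repeated shifting brings the last nonempty component to `∅` or `{0}`, and a lone `0` is
removed by recognizing it as fed. Induction on the number of components leads to the initial state.

Distinguishability (`exists_distinguishing`): a difference in component `k` is rotated to the last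
state, where it decides whether component `k + 1` is fed. The contraction and a rotation make that
visible as presence or absence of `0` in component `k + 1`, and so on to the final component.

Components are indexed by all of `ℕ` in these two arguments, which avoids boundary cases: the first
`α` components do not depend on later ones, and letters beyond `α` do not affect them. -/

namespace MultiCatenation

/-! ### The subset automaton and its backward steps -/

/-- The image of `X` under the contraction sending `1` to `0`. -/
def contractImage (X : Set ℕ) : Set ℕ := {x | x ≠ 1 ∧ (x ∈ X ∨ x = 0 ∧ 1 ∈ X)}

/-- The image of `X` under the transposition `(0, 1)`. -/
def swapImage (X : Set ℕ) : Set ℕ := {x | x = 0 ∧ 1 ∈ X ∨ x = 1 ∧ 0 ∈ X ∨ 2 ≤ x ∧ x ∈ X}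

/-- The image of `X` under the cycle `(0, 1, …, m - 1)`. -/
def cycleImage (m : ℕ) (X : Set ℕ) : Set ℕ :=
  {x | x = 0 ∧ m - 1 ∈ X ∨ 1 ≤ x ∧ x < m ∧ x - 1 ∈ X}

/-- The image of `X` under the action of the letter `a` on the `k`-th component. -/
def letterImage (n : ℕ → ℕ) (a k : ℕ) (X : Set ℕ) : Set ℕ :=
  if a + 1 = k then contractImage X
  else if a = k then swapImage X
  else if a = k + 1 then cycleImage (n k) X
  else X

theorem letterImage_contract (n : ℕ → ℕ) (a : ℕ) (X : Set ℕ) :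
    letterImage n a (a + 1) X = contractImage X := by simp [letterImage]

theorem letterImage_swap (n : ℕ → ℕ) (a : ℕ) (X : Set ℕ) :
    letterImage n a a X = swapImage X := by simp [letterImage]

theorem letterImage_cycle (n : ℕ → ℕ) (k : ℕ) (X : Set ℕ) :
    letterImage n (k + 1) k X = cycleImage (n k) X := by
  simp [letterImage, show k + 1 + 1 ≠ k by omega]

theorem letterImage_other (n : ℕ → ℕ) {a k : ℕ} (X : Set ℕ) (h₁ : a + 1 ≠ k) (h₂ : a ≠ k)
    (h₃ : a ≠ k + 1) : letterImage n a k X = X := by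
  simp [letterImage, h₁, h₂, h₃]

theorem last_mem_swapImage {m : ℕ} (hm : 3 ≤ m) {X : Set ℕ} :
    m - 1 ∈ swapImage X ↔ m - 1 ∈ X := by
  simp only [swapImage, Set.mem_ofPred_eq]
  grind

/-- The component preceding the `k`-th one contains its final state. -/
def Fed (n : ℕ → ℕ) (S : ℕ → Set ℕ) : ℕ → Prop
  | 0 => False
  | k + 1 => n k - 1 ∈ S k

/-- One step of the subset automaton of the catenation of the witness automata, on infinitely many
components. -/
def subsetStep (n : ℕ → ℕ) (a : ℕ) (S : ℕ → Set ℕ) (k : ℕ) : Set ℕ :=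
  {x | x ∈ letterImage n a k (S k) ∨ x = 0 ∧ Fed n (fun j => letterImage n a j (S j)) k}

/-- Valid sequences with infinitely many components. -/
structure ValidSeq (n : ℕ → ℕ) (S : ℕ → Set ℕ) : Prop where
  bound : ∀ k, ∀ x ∈ S k, x < n k
  singleton : ∃ q, S 0 = {q}
  empty : ∀ k, S k = ∅ → S (k + 1) = ∅
  final : ∀ k, n k - 1 ∈ S k → 0 ∈ S (k + 1)

/-- `T` is obtained from `S` by reading some word. -/
def Reaches (n : ℕ → ℕ) : (ℕ → Set ℕ) → (ℕ → Set ℕ) → Prop :=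
  Relation.ReflTransGen fun S T => ∃ a, T = subsetStep n a S

variable {n : ℕ → ℕ} {S : ℕ → Set ℕ}

theorem ValidSeq.fed (hS : ValidSeq n S) {k : ℕ} (h : Fed n S k) : 0 ∈ S k := by
  cases k with
  | zero => exact h.elim
  | succ k => exact hS.final k h

theorem ValidSeq.nonempty_of_succ (hS : ValidSeq n S) {k x : ℕ} (h : x ∈ S (k + 1)) :
    (S k).Nonempty := by
  rw [Set.nonempty_iff_ne_empty]
  intro h0
  simp [hS.empty k h0] at h

/-- The sequence `S` with three consecutive components replaced. -/
def replaceThree (S : ℕ → Set ℕ) (k : ℕ) (X Y C : Set ℕ) (j : ℕ) : Set ℕ :=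
  if j = k then X else if j = k + 1 then Y else if j = k + 2 then C else S j

theorem replaceThree_of_lt {k j : ℕ} {X Y C : Set ℕ} (h : k + 2 < j) :
    replaceThree S k X Y C j = S j := by
  simp [replaceThree, show j ≠ k by omega, show j ≠ k + 1 by omega, show j ≠ k + 2 by omega]

theorem replaceThree_below {k j : ℕ} {X Y C : Set ℕ} (h : j < k) :
    replaceThree S k X Y C j = S j := by
  simp [replaceThree, show j ≠ k by omega, show j ≠ k + 1 by omega, show j ≠ k + 2 by omega]

@[simp] theorem replaceThree_zero {k : ℕ} {X Y C : Set ℕ} :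
    replaceThree S k X Y C k = X := by
  simp [replaceThree]

@[simp] theorem replaceThree_one {k : ℕ} {X Y C : Set ℕ} :
    replaceThree S k X Y C (k + 1) = Y := by
  simp [replaceThree]

@[simp] theorem replaceThree_two {k : ℕ} {X Y C : Set ℕ} :
    replaceThree S k X Y C (k + 2) = C := by
  simp [replaceThree]

theorem fed_congr {T : ℕ → Set ℕ} {k : ℕ} (h : ∀ j, k = j + 1 → (n j - 1 ∈ S j ↔ n j - 1 ∈ T j)) :
    Fed n S k ↔ Fed n T k := by
  cases k with
  | zero => rfl
  | succ k => exact h k rfl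

/-- A predecessor under the letter acting as the cycle on the `k`-th component. -/
theorem cycle_predecessor (hn : ∀ k, 3 ≤ n k) (hS : ValidSeq n S) (k : ℕ) {X Y C : Set ℕ}
    (hXb : ∀ x ∈ X, x < n k) (hX0 : k = 0 → ∃ q, X = {q}) (hXne : X.Nonempty)
    (hX : ∀ x, x ∈ S k ↔ x ∈ cycleImage (n k) X ∨ x = 0 ∧ Fed n S k)
    (hXf : Fed n S k → 0 ∈ X)
    (hYb : ∀ x ∈ Y, x < n (k + 1))
    (hY : ∀ x, x ∈ S (k + 1) ↔ x ∈ swapImage Y ∨ x = 0 ∧ n k - 1 ∈ S k)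
    (hXY : n k - 1 ∈ X → 0 ∈ Y) (hYC : Y = ∅ → C = ∅)
    (hCb : ∀ x ∈ C, x < n (k + 2))
    (hC : ∀ x, x ∈ S (k + 2) ↔ x ∈ contractImage C ∨ x = 0 ∧ n (k + 1) - 1 ∈ S (k + 1))
    (hYC' : n (k + 1) - 1 ∈ Y → 0 ∈ C) (hCS : C = ∅ → S (k + 3) = ∅)
    (hCS' : n (k + 2) - 1 ∈ C → 0 ∈ S (k + 3)) :
    ValidSeq n (replaceThree S k X Y C) ∧
      Reaches n (replaceThree S k X Y C) S := by
  have h0 := hn k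
  have h1 := hn (k + 1)
  have h2 := hn (k + 2)
  refine ⟨⟨?_, ?_, ?_, ?_⟩, .single ⟨k + 1, ?_⟩⟩
  · intro j x
    unfold replaceThree
    split_ifs with c1 c2 c3
    · subst c1; exact hXb x
    · subst c2; exact hYb x
    · subst c3; exact hCb x
    · exact hS.bound j x
  · by_cases c : k = 0
    · subst c; simpa using hX0 rfl
    · simpa [replaceThree, Ne.symm c] using hS.singleton
  · intro j
    rcases lt_trichotomy j k with hj | rfl | hj
    · by_cases hjk : j + 1 = k
      · intro h
        have hSk : S k = ∅ := by
          rw [← hjk]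
          apply hS.empty
          simpa [replaceThree, show j ≠ k by omega, show j ≠ k + 1 by omega,
            show j ≠ k + 2 by omega] using h
        obtain ⟨x, hx⟩ := hXne
        have hx' := hXb x hx
        exfalso
        by_cases hxn : x = n k - 1
        · have := (hX 0).2 (.inl (.inl ⟨rfl, hxn ▸ hx⟩))
          simp [hSk] at this
        · have := (hX (x + 1)).2 (.inl (.inr ⟨by omega, by omega, by simpa using hx⟩))
          simp [hSk] at this
      · simpa [replaceThree, show j ≠ k by omega, show j ≠ k + 1 by omega,
            show j ≠ k + 2 by omega, show j + 1 ≠ k by omega, show j + 1 ≠ k + 2 by omega]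
            using hS.empty j
    · intro h; simp at h; simp [h] at hXne
    · by_cases c1 : j = k + 1
      · subst c1; simpa using hYC
      · by_cases c2 : j = k + 2
        · subst c2; simpa [replaceThree_of_lt] using hCS
        · rw [replaceThree_of_lt (by omega), replaceThree_of_lt (by omega)]
          exact hS.empty j
  · intro j
    rcases lt_trichotomy j k with hj | rfl | hj
    · by_cases hjk : j + 1 = k
      · subst hjk
        simpa [replaceThree, Fed, show j ≠ j + 1 + 1 by omega, show j ≠ j + 1 + 2 by omega] using hXf
      · simpa [replaceThree, show j ≠ k by omega, show j ≠ k + 1 by omega,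
            show j ≠ k + 2 by omega, show j + 1 ≠ k by omega, show j + 1 ≠ k + 2 by omega]
            using hS.final j
    · simpa using hXY
    · by_cases c1 : j = k + 1
      · subst c1; simpa using hYC'
      · by_cases c2 : j = k + 2
        · subst c2; simpa [replaceThree_of_lt] using hCS'
        · rw [replaceThree_of_lt (by omega), replaceThree_of_lt (by omega)]
          exact hS.final j
  -- Letter images and components of `S` differ at most by an inserted `0`, and last states are
  -- nonzero, so both feed the same components.
  · have hf : ∀ j, n j - 1 ∈ letterImage n (k + 1) j (replaceThree S k X Y C j) ↔
        n j - 1 ∈ S j := by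
      intro j
      have hj : n j - 1 ≠ 0 := by have := hn j; omega
      by_cases c0 : j = k
      · subst c0
        rw [letterImage_cycle, replaceThree_zero, hX]
        simp [hj]
      · by_cases c1 : j = k + 1
        · subst c1
          rw [letterImage_swap, replaceThree_one, hY]
          simp [hj]
        · by_cases c2 : j = k + 2
          · subst c2
            rw [letterImage_contract, replaceThree_two, hC]
            simp [hj]
          · rw [letterImage_other _ _ (by omega) (by omega) (by omega)]
            simp [replaceThree, c0, c1, c2]
    have hf' : ∀ j, Fed n (fun j => letterImage n (k + 1) j (replaceThree S k X Y C j)) j ↔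
        Fed n S j := fun j => fed_congr fun i _ => hf i
    funext j
    ext x
    simp only [subsetStep, Set.mem_ofPred_eq, hf']
    by_cases c0 : j = k
    · subst c0
      rw [letterImage_cycle, replaceThree_zero, hX]
    · by_cases c1 : j = k + 1
      · subst c1
        rw [letterImage_swap, replaceThree_one, hY, Fed]
      · by_cases c2 : j = k + 2
        · subst c2
          rw [letterImage_contract, replaceThree_two, hC, Fed]
        · rw [letterImage_other _ _ (by omega) (by omega) (by omega)]
          simp only [replaceThree, c0, c1, c2, if_false]
          constructor
          · exact .inl
          · rintro (h | ⟨rfl, h⟩)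
            exacts [h, hS.fed h]

end MultiCatenation

/-! ### Shifting and rotating a component backwards -/

namespace MultiCatenation
variable {n : ℕ → ℕ} {S : ℕ → Set ℕ}

theorem one_lt_of (hn : ∀ k, 3 ≤ n k) (k : ℕ) : 1 < n k := lt_of_lt_of_le (by norm_num) (hn k)

theorem swapImage_eq_empty {X : Set ℕ} (h : swapImage X = ∅) : X = ∅ := by
  ext x
  simp only [Set.mem_empty_iff_false, iff_false]
  intro hx
  have h' : ∀ y, y ∉ swapImage X := by simp [h]
  rcases x with _ | _ | x
  · exact h' 1 (.inr (.inl ⟨rfl, hx⟩))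
  · exact h' 0 (.inl ⟨rfl, hx⟩)
  · exact h' (x + 2) (.inr (.inr ⟨by omega, hx⟩))

theorem mem_swapImage_swapImage {X : Set ℕ} {x : ℕ} : x ∈ swapImage (swapImage X) ↔ x ∈ X := by
  simp only [swapImage, Set.mem_ofPred_eq]
  grind

theorem zero_mem_swapImage {X : Set ℕ} : 0 ∈ swapImage X ↔ 1 ∈ X := by
  simp [swapImage]

theorem mem_swapImage_of_two_le {X : Set ℕ} {x : ℕ} (hx : 2 ≤ x) :
    x ∈ swapImage X ↔ x ∈ X := by
  simp only [swapImage, Set.mem_ofPred_eq]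
  grind

theorem swapImage_eq_self {X : Set ℕ} (h0 : 0 ∈ X) (h1 : 1 ∈ X) : swapImage X = X := by
  ext x
  simp only [swapImage, Set.mem_ofPred_eq]
  grind

theorem swapImage_lt {X : Set ℕ} {m : ℕ} (hm : 3 ≤ m) (h : ∀ x ∈ X, x < m) :
    ∀ x ∈ swapImage X, x < m := by
  simp only [swapImage, Set.mem_ofPred_eq]
  grind

/-- Contraction only merges `1` into `0`, so a preimage may carry an extra `1` exactly when `0` is
already present. -/
theorem contractImage_eq {X C : Set ℕ} (h : 1 ∉ X) (hC : C = X ∨ 0 ∈ X ∧ C = insert 1 X) :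
    contractImage C = X := by
  ext x
  simp only [contractImage, Set.mem_ofPred_eq]
  rcases hC with rfl | ⟨h0, rfl⟩
  · grind
  · simp only [Set.mem_insert_iff]
    grind

/-- The transposition is an involution, and validity of `S` already accounts for the zeros fed into
components `k + 1` and `k + 2`. The condition `h1` is forced, since neither contraction nor feeding
produces `1`; `hXY` says that the swapped component contains `0` whenever `X` feeds it. -/
theorem cycle_predecessor_swap (hn : ∀ k, 3 ≤ n k) (hS : ValidSeq n S) (k : ℕ) {X C : Set ℕ}
    (hXb : ∀ x ∈ X, x < n k) (hX0 : k = 0 → ∃ q, X = {q}) (hXne : X.Nonempty)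
    (hX : ∀ x, x ∈ S k ↔ x ∈ cycleImage (n k) X ∨ x = 0 ∧ Fed n S k)
    (hXf : Fed n S k → 0 ∈ X) (hXY : n k - 1 ∈ X → 1 ∈ S (k + 1)) (h1 : 1 ∉ S (k + 2))
    (hC : C = S (k + 2) ∨ 0 ∈ S (k + 2) ∧ C = insert 1 (S (k + 2))) :
    ValidSeq n (replaceThree S k X (swapImage (S (k + 1))) C) ∧
      Reaches n (replaceThree S k X (swapImage (S (k + 1))) C) S := by
  have hlast : ∀ {m}, 3 ≤ m → m - 1 ∈ C → m - 1 ∈ S (k + 2) := by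
    intro m hm h
    rcases hC with rfl | ⟨-, rfl⟩
    · exact h
    · rcases h with h | h
      · omega
      · exact h
  apply cycle_predecessor hn hS k hXb hX0 hXne hX hXf
  · exact swapImage_lt (hn _) (hS.bound _)
  · intro x
    rw [mem_swapImage_swapImage]
    exact ⟨.inl, fun h => h.elim id fun ⟨h, h'⟩ => h ▸ hS.final _ h'⟩
  · rwa [zero_mem_swapImage]
  · intro h
    have h' := hS.empty _ (swapImage_eq_empty h)
    rcases hC with rfl | ⟨h0, -⟩
    · exact h'
    · simp [h'] at h0
  · rcases hC with rfl | ⟨h0, rfl⟩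
    · exact hS.bound _
    · rintro x (rfl | hx)
      exacts [one_lt_of hn _, hS.bound _ _ hx]
  · intro x
    rw [contractImage_eq h1 hC]
    exact ⟨.inl, fun h => h.elim id fun ⟨h, h'⟩ => h ▸ hS.final _ h'⟩
  · rw [last_mem_swapImage (hn _)]
    intro h
    have h' := hS.final _ h
    rcases hC with rfl | ⟨h0, rfl⟩
    exacts [h', .inr h']
  · intro h
    rcases hC with rfl | ⟨h0, rfl⟩
    exacts [hS.empty _ h, absurd h (Set.insert_nonempty _ _).ne_empty]
  · exact fun h => hS.final _ (hlast (hn _) h)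

/-- The component `k` arises from shifting down, the element `0` being inserted by the preceding
component. -/
def Shiftable (n : ℕ → ℕ) (S : ℕ → Set ℕ) (k : ℕ) : Prop := 0 ∉ S k ∨ 1 ∈ S k ∧ Fed n S k

theorem Shiftable.nonempty_shift {k : ℕ} (hg : Shiftable n S k) (hne : (S k).Nonempty) :
    {t | t + 1 ∈ S k}.Nonempty := by
  rcases hg with h0 | ⟨h1, -⟩
  · obtain ⟨x, hx⟩ := hne
    rcases x with _ | x
    · exact absurd hx h0
    · exact ⟨x, hx⟩
  · exact ⟨0, h1⟩

theorem Shiftable.singleton_shift (hS : ValidSeq n S) (hg : Shiftable n S 0) :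
    ∃ q, {t | t + 1 ∈ S 0} = ({q} : Set ℕ) := by
  obtain ⟨q, hq⟩ := hS.singleton
  rcases hg with h0 | ⟨-, h⟩
  · rcases q with _ | q
    · simp [hq] at h0
    · refine ⟨q, ?_⟩
      ext t
      simp [hq]
  · exact h.elim

theorem Shiftable.mem_iff (hn : ∀ k, 3 ≤ n k) (hS : ValidSeq n S) {k : ℕ}
    (hg : Shiftable n S k) (x : ℕ) :
    x ∈ S k ↔ x ∈ cycleImage (n k) {t | t + 1 ∈ S k} ∨ x = 0 ∧ Fed n S k := by
  have hk := hn k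
  have hb : n k ∉ S k := fun h => lt_irrefl _ (hS.bound _ _ h)
  simp only [cycleImage, Set.mem_ofPred_eq]
  rw [show n k - 1 + 1 = n k by omega]
  rcases x with _ | x
  · simp [hb]
    exact ⟨fun h => hg.elim (absurd h) (·.2), hS.fed⟩
  · simp
    exact hS.bound _ _

/-- A `0` in component `k` is lost by shifting down and must come back by feeding. In that case the
predecessor is fed as well, so the shifted set needs a `0`; this is why `Shiftable` asks for `1 ∈ S
k`. -/
theorem shift_predecessor (hn : ∀ k, 3 ≤ n k) (hS : ValidSeq n S) {k : ℕ} {C : Set ℕ}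
    (hne : (S k).Nonempty) (hg : Shiftable n S k) (h1 : 1 ∉ S (k + 2))
    (hC : C = S (k + 2) ∨ 0 ∈ S (k + 2) ∧ C = insert 1 (S (k + 2))) :
    ValidSeq n (replaceThree S k {t | t + 1 ∈ S k} (swapImage (S (k + 1))) C) ∧
      Reaches n (replaceThree S k {t | t + 1 ∈ S k} (swapImage (S (k + 1))) C) S := by
  have hk := hn k
  have hb : n k ∉ S k := fun h => lt_irrefl _ (hS.bound _ _ h)
  apply cycle_predecessor_swap hn hS k _ _ (hg.nonempty_shift hne) (hg.mem_iff hn hS) _ _ h1 hC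
  · intro x hx
    have := hS.bound _ _ hx
    omega
  · rintro rfl
    exact hg.singleton_shift hS
  · intro h
    rcases hg with h0 | ⟨h1, -⟩
    · exact absurd (hS.fed h) h0
    · exact h1
  · simp only [Set.mem_ofPred_eq]
    rw [show n k - 1 + 1 = n k by omega]
    exact fun h => absurd h hb

/-- Here `0` in component `k` is explained by the cycle instead, so it moves back to the last state.
That state feeds component `k + 1` of the predecessor, whence `h01`. -/
theorem rotate_predecessor (hn : ∀ k, 3 ≤ n k) (hS : ValidSeq n S) {k : ℕ} {C : Set ℕ}
    (h0 : 0 ∈ S k) (hf : Fed n S k → 1 ∈ S k) (h01 : 1 ∈ S (k + 1)) (h1 : 1 ∉ S (k + 2))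
    (hC : C = S (k + 2) ∨ 0 ∈ S (k + 2) ∧ C = insert 1 (S (k + 2))) :
    ∃ X : Set ℕ, n k - 1 ∈ X ∧ ValidSeq n (replaceThree S k X (swapImage (S (k + 1))) C) ∧
      Reaches n (replaceThree S k X (swapImage (S (k + 1))) C) S := by
  have hk := hn k
  have hb : n k ∉ S k := fun h => lt_irrefl _ (hS.bound _ _ h)
  refine ⟨{t | t + 1 ∈ S k ∨ t = n k - 1}, .inr rfl, ?_⟩
  apply cycle_predecessor_swap hn hS k _ _ ⟨n k - 1, .inr rfl⟩ _ (fun h => .inl (hf h))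
    (fun _ => h01) h1 hC
  · rintro x (hx | rfl)
    · have := hS.bound _ _ hx
      omega
    · omega
  · rintro rfl
    obtain ⟨q, hq⟩ := hS.singleton
    have hq0 : 0 = q := by simpa [hq] using h0
    refine ⟨n 0 - 1, ?_⟩
    ext t
    simp [hq, ← hq0]
  · intro x
    simp only [cycleImage, Set.mem_ofPred_eq]
    rcases x with _ | x
    · simp [h0]
    · simp
      constructor
      · intro h
        exact ⟨hS.bound _ _ h, .inl h⟩
      · rintro ⟨h, h' | h'⟩
        · exact h'
        · omega

/-- A predecessor under the letter acting as the transposition on the first component. -/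
theorem zero_predecessor (hn : ∀ k, 3 ≤ n k) (hS : ValidSeq n S) {C : Set ℕ} (h1 : 1 ∉ S 1)
    (hC : C = S 1 ∨ 0 ∈ S 1 ∧ C = insert 1 (S 1)) :
    ∃ T, T 0 = swapImage (S 0) ∧ T 1 = C ∧ (∀ j, 2 ≤ j → T j = S j) ∧ ValidSeq n T ∧
      Reaches n T S := by
  obtain ⟨q, hq⟩ := hS.singleton
  have hlast : ∀ {m}, 3 ≤ m → (m - 1 ∈ C ↔ m - 1 ∈ S 1) := by
    intro m hm
    rcases hC with rfl | ⟨-, rfl⟩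
    · rfl
    · rw [Set.mem_insert_iff, or_iff_right (by omega)]
  have hsub : S 1 ⊆ C := by
    rcases hC with rfl | ⟨-, rfl⟩
    exacts [subset_rfl, Set.subset_insert _ _]
  refine ⟨fun j => if j = 0 then swapImage (S 0) else if j = 1 then C else S j, by simp, by simp,
    fun j hj => by simp [show j ≠ 0 by omega, show j ≠ 1 by omega], ⟨?_, ?_, ?_, ?_⟩,
    .single ⟨0, ?_⟩⟩
  · rintro (_ | _ | j)
    · simpa using swapImage_lt (hn _) (hS.bound _)
    · intro x hx
      simp only [show (0 + 1 : ℕ) ≠ 0 by omega, if_false] at hx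
      rcases hC with rfl | ⟨-, rfl⟩
      · exact hS.bound _ _ hx
      · rcases hx with rfl | hx
        exacts [one_lt_of hn _, hS.bound _ _ hx]
    · simpa using hS.bound _
  · refine ⟨if q = 0 then 1 else if q = 1 then 0 else q, ?_⟩
    ext x
    simp only [swapImage, hq, if_true, Set.mem_ofPred_eq, Set.mem_singleton_iff]
    grind
  · rintro (_ | _ | j)
    · intro h
      simp only [if_true] at h
      have := swapImage_eq_empty h
      simp [hq] at this
    · intro h
      simp only [show (0 + 1 : ℕ) ≠ 0 by omega, if_false] at h
      have : S 1 = ∅ := Set.subset_eq_empty hsub (by simpa using h)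
      simpa using hS.empty _ this
    · simpa using hS.empty (j + 2)
  · rintro (_ | _ | j)
    · simp only [if_true, last_mem_swapImage (hn _)]
      intro h
      exact hsub (hS.final _ h)
    · simp only [zero_add, one_ne_zero, if_false, if_true, hlast (hn _)]
      simpa using hS.final _
    · simpa using hS.final (j + 2)
  · set T : ℕ → Set ℕ := fun j => if j = 0 then swapImage (S 0) else if j = 1 then C else S j
      with hT
    have himg : ∀ j, letterImage n 0 j (T j) = S j := by
      rintro (_ | _ | j)
      · rw [letterImage_swap]
        ext x
        exact mem_swapImage_swapImage
      · rw [letterImage_contract]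
        exact contractImage_eq h1 hC
      · rw [letterImage_other _ _ (by omega) (by omega) (by omega)]
        simp [hT]
    funext k
    ext x
    simp only [subsetStep, himg, Set.mem_ofPred_eq]
    exact ⟨.inl, fun h => h.elim id fun ⟨h, h'⟩ => h ▸ hS.fed h'⟩

end MultiCatenation

/-! ### Preparing a component by modifying only earlier ones -/

namespace MultiCatenation
variable {n : ℕ → ℕ} {S : ℕ → Set ℕ}

/-- Every valid sequence whose component `k + 1` misses `1` can be traced back to one whose
component `k` is shiftable. -/
def CanMakeShiftable (n : ℕ → ℕ) (k : ℕ) : Prop :=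
  ∀ S, ValidSeq n S → 1 ∉ S (k + 1) → ∃ T, ValidSeq n T ∧ Shiftable n T k ∧
    (∀ j, k < j → T j = S j) ∧ (∀ x, 2 ≤ x → (x ∈ T k ↔ x ∈ S k)) ∧ Reaches n T S

/-- Every valid sequence whose component `k + 1` contains `0` but not `1` can be traced back to one
where `1` is added to that component. -/
def CanInsertOne (n : ℕ → ℕ) (k : ℕ) : Prop :=
  ∀ S, ValidSeq n S → 0 ∈ S (k + 1) → 1 ∉ S (k + 1) → ∃ T, ValidSeq n T ∧
    T (k + 1) = insert 1 (S (k + 1)) ∧ (∀ j, k + 1 < j → T j = S j) ∧ Reaches n T S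

theorem replaceThree_eq_above {k : ℕ} {X : Set ℕ} (h0 : 0 ∈ S (k + 1)) (h1 : 1 ∈ S (k + 1))
    (j : ℕ) (hj : k < j) :
    replaceThree S k X (swapImage (S (k + 1))) (S (k + 2)) j = S j := by
  by_cases c1 : j = k + 1
  · subst c1
    simpa using swapImage_eq_self h0 h1
  · by_cases c2 : j = k + 2
    · subst c2; simp
    · exact replaceThree_of_lt (by omega)

/-- Component `k` is turned back until some element passes from `0` to the last state. With both `0`
and `1` present in component `k + 1`, the accompanying swaps leave it unchanged. -/
theorem exists_feed_of_mem (hn : ∀ k, 3 ≤ n k) {k : ℕ} (m : ℕ) :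
    ∀ S, ValidSeq n S → ¬ Fed n S k → m ∈ S k → 0 ∈ S (k + 1) → 1 ∈ S (k + 1) →
      1 ∉ S (k + 2) → ∃ T, ValidSeq n T ∧ (∀ j, k < j → T j = S j) ∧ n k - 1 ∈ T k ∧
        Reaches n T S := by
  induction m with
  | zero =>
    intro S hS hf hm h0 h1 h2
    obtain ⟨X, hX, hT, hr⟩ :=
      rotate_predecessor hn hS hm (fun h => absurd h hf) h1 h2 (.inl rfl)
    exact ⟨_, hT, replaceThree_eq_above h0 h1, by simpa using hX, hr⟩
  | succ m ih =>
    intro S hS hf hm h0 h1 h2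
    by_cases hz : 0 ∈ S k
    · obtain ⟨X, hX, hT, hr⟩ :=
        rotate_predecessor hn hS hz (fun h => absurd h hf) h1 h2 (.inl rfl)
      exact ⟨_, hT, replaceThree_eq_above h0 h1, by simpa using hX, hr⟩
    · obtain ⟨hT, hr⟩ := shift_predecessor hn hS ⟨_, hm⟩ (.inl hz) h2 (.inl rfl)
      have hTj : ∀ j, k < j → replaceThree S k {t | t + 1 ∈ S k} (swapImage (S (k + 1)))
          (S (k + 2)) j = S j := replaceThree_eq_above h0 h1
      obtain ⟨T, hT', hTj', hl, hr'⟩ := ih _ hT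
        (by
          rwa [fed_congr (T := S)]
          rintro j rfl
          rw [replaceThree_below (by omega)])
        (by simpa using hm) (by rwa [hTj _ (by omega)])
        (by rwa [hTj _ (by omega)]) (by rwa [hTj _ (by omega)])
      exact ⟨T, hT', fun j hj => (hTj' j hj).trans (hTj j hj), hl, hr'.trans hr⟩

/-- When component `k` is itself fed it contains `0`, and rotating it backwards only requires a `1`
as well; `CanInsertOne` one level below provides it. -/
theorem exists_feed (hn : ∀ k, 3 ≤ n k) {k : ℕ} (hI : ∀ i, i + 1 = k → CanInsertOne n i)
    (hS : ValidSeq n S) (h0 : 0 ∈ S (k + 1)) (h1 : 1 ∈ S (k + 1)) (h2 : 1 ∉ S (k + 2)) :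
    ∃ T, ValidSeq n T ∧ (∀ j, k < j → T j = S j) ∧ n k - 1 ∈ T k ∧ Reaches n T S := by
  by_cases hf : Fed n S k
  · have hz := hS.fed hf
    suffices ∃ T, ValidSeq n T ∧ 0 ∈ T k ∧ 1 ∈ T k ∧ (∀ j, k < j → T j = S j) ∧ Reaches n T S by
      obtain ⟨T, hT, hT0, hT1, hTj, hr⟩ := this
      obtain ⟨X, hX, hT', hr'⟩ := rotate_predecessor hn hT hT0 (fun _ => hT1)
        (by rwa [hTj _ (by omega)]) (by rwa [hTj _ (by omega)]) (.inl rfl)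
      have e1 := hTj (k + 1) (by omega)
      exact ⟨_, hT', fun j hj => (replaceThree_eq_above (by rwa [e1]) (by rwa [e1]) j hj).trans
        (hTj j hj), by simpa using hX, hr'.trans hr⟩
    by_cases ho : 1 ∈ S k
    · exact ⟨S, hS, hz, ho, fun _ _ => rfl, .refl⟩
    · cases k with
      | zero => exact hf.elim
      | succ i =>
        obtain ⟨T, hT, hTi, hTj, hr⟩ := hI i rfl S hS hz ho
        exact ⟨T, hT, by simp [hTi, hz], by simp [hTi], hTj, hr⟩
  · obtain ⟨m, hm⟩ := hS.nonempty_of_succ h0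
    exact exists_feed_of_mem hn m S hS hf hm h0 h1 h2

theorem canMakeShiftable_zero (hn : ∀ k, 3 ≤ n k) : CanMakeShiftable n 0 := by
  intro S hS h1
  by_cases h0 : 0 ∈ S 0
  · obtain ⟨q, hq⟩ := hS.singleton
    have hq0 : 0 = q := by simpa [hq] using h0
    obtain ⟨T, hT0, hT1, hTj, hT, hr⟩ := zero_predecessor hn hS h1 (.inl rfl)
    refine ⟨T, hT, .inl ?_, ?_, ?_, hr⟩
    · rw [hT0, zero_mem_swapImage]
      simp [hq, ← hq0]
    · intro j hj
      by_cases c : j = 1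
      · rw [c, hT1]
      · exact hTj j (by omega)
    · intro x hx
      rw [hT0, mem_swapImage_of_two_le hx]
  · exact ⟨S, hS, .inl h0, fun _ _ => rfl, fun _ _ => .rfl, .refl⟩

/-- If component `k + 1` contains both `0` and `1`, it suffices to feed it. If it contains `0` only,
shifting component `k` down swaps that `0` into a `1`. -/
theorem canMakeShiftable_succ (hn : ∀ k, 3 ≤ n k) {k : ℕ} (hk : CanMakeShiftable n k)
    (hI : ∀ i, i + 1 = k → CanInsertOne n i) : CanMakeShiftable n (k + 1) := by
  intro S hS h2
  by_cases h0 : 0 ∈ S (k + 1)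
  · by_cases h1 : 1 ∈ S (k + 1)
    · obtain ⟨T, hT, hTj, hl, hr⟩ := exists_feed hn hI hS h0 h1 h2
      refine ⟨T, hT, .inr ⟨by rwa [hTj _ (by omega)], hl⟩, fun j hj => hTj j (by omega), ?_, hr⟩
      intro x _
      rw [hTj _ (by omega)]
    · obtain ⟨T, hT, hg, hTj, -, hr⟩ := hk S hS h1
      obtain ⟨hT', hr'⟩ := shift_predecessor hn hT
        (hT.nonempty_of_succ (by rw [hTj _ (by omega)]; exact h0)) hg
        (by rwa [hTj _ (by omega)]) (.inl rfl)
      refine ⟨_, hT', .inl ?_, ?_, ?_, hr'.trans hr⟩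
      · rw [replaceThree_one, zero_mem_swapImage, hTj _ (by omega)]
        exact h1
      · intro j hj
        rw [← hTj j (by omega)]
        by_cases c2 : j = k + 2
        · subst c2; simp
        · exact replaceThree_of_lt (by omega)
      · intro x hx
        rw [replaceThree_one, mem_swapImage_of_two_le hx, hTj _ (by omega)]
  · exact ⟨S, hS, .inl h0, fun _ _ => rfl, fun _ _ => .rfl, .refl⟩

theorem canInsertOne_zero (hn : ∀ k, 3 ≤ n k) : CanInsertOne n 0 := by
  intro S hS h0 h1
  obtain ⟨T, -, hT1, hTj, hT, hr⟩ := zero_predecessor hn hS h1 (.inr ⟨h0, rfl⟩)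
  exact ⟨T, hT, hT1, fun j hj => hTj j (by omega), hr⟩

/-- The `1` appears in component `k + 2` when letter `k + 1` is undone. So component `k` must be
rotated or shifted back; the cases record which of the two is possible, after a preparation of
earlier components if necessary. -/
theorem canInsertOne_succ (hn : ∀ k, 3 ≤ n k) {k : ℕ} (hk : CanMakeShiftable n k)
    (hI : ∀ i, i + 1 = k → CanInsertOne n i) : CanInsertOne n (k + 1) := by
  intro S hS h0 h1
  have hne := hS.nonempty_of_succ h0
  obtain ⟨y, hy⟩ := hne
  have hne' := hS.nonempty_of_succ hy
  have key : ∀ T : ℕ → Set ℕ, (∀ j, k < j → T j = S j) →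
      T (k + 2) = S (k + 2) ∧ 0 ∈ T (k + 2) ∧ 1 ∉ T (k + 2) ∧ T (k + 1) = S (k + 1) := by
    intro T hTj
    rw [hTj (k + 2) (by omega), hTj (k + 1) (by omega)]
    exact ⟨rfl, h0, h1, rfl⟩
  have finish : ∀ (T : ℕ → Set ℕ) (X : Set ℕ), (∀ j, k < j → T j = S j) → ∀ j, k + 2 < j →
      replaceThree T k X (swapImage (T (k + 1))) (insert 1 (T (k + 2))) j = S j := by
    intro T X hTj j hj
    rw [replaceThree_of_lt hj]
    exact hTj j (by omega)
  by_cases ho : 1 ∈ S (k + 1)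
  · suffices ∃ T, ValidSeq n T ∧ (0 ∈ T k → Fed n T k → 1 ∈ T k) ∧ (∀ j, k < j → T j = S j) ∧
        Reaches n T S by
      obtain ⟨T, hT, hT01, hTj, hr⟩ := this
      obtain ⟨e2, e0, e1, e3⟩ := key T hTj
      by_cases hz : 0 ∈ T k
      · obtain ⟨X, hX, hT', hr'⟩ := rotate_predecessor hn hT hz (hT01 hz)
          (by rwa [e3]) e1 (.inr ⟨e0, rfl⟩)
        exact ⟨_, hT', by simp [e2], finish T _ hTj, hr'.trans hr⟩
      · obtain ⟨hT', hr'⟩ := shift_predecessor hn hT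
          (hT.nonempty_of_succ (by rw [e3]; exact ho)) (.inl hz) e1 (.inr ⟨e0, rfl⟩)
        exact ⟨_, hT', by simp [e2], finish T _ hTj, hr'.trans hr⟩
    by_cases hc : 0 ∈ S k → Fed n S k → 1 ∈ S k
    · exact ⟨S, hS, hc, fun _ _ => rfl, .refl⟩
    · push Not at hc
      obtain ⟨hz, hf, ho'⟩ := hc
      cases k with
      | zero => exact hf.elim
      | succ i =>
        obtain ⟨T, hT, hTi, hTj, hr⟩ := hI i rfl S hS hz ho'
        exact ⟨T, hT, by simp [hTi], hTj, hr⟩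
  · obtain ⟨T, hT, hg, hTj, -, hr⟩ := hk S hS ho
    obtain ⟨e2, e0, e1, e3⟩ := key T hTj
    obtain ⟨hT', hr'⟩ := shift_predecessor hn hT
      (hT.nonempty_of_succ (by rw [e3]; exact hy)) hg e1 (.inr ⟨e0, rfl⟩)
    exact ⟨_, hT', by simp [e2], finish T _ hTj, hr'.trans hr⟩

theorem canMakeShiftable_and_canInsertOne (hn : ∀ k, 3 ≤ n k) (k : ℕ) :
    CanMakeShiftable n k ∧ CanInsertOne n k := by
  induction k using Nat.strong_induction_on with
  | _ k ih =>
    cases k with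
    | zero => exact ⟨canMakeShiftable_zero hn, canInsertOne_zero hn⟩
    | succ k =>
      have hk := (ih k (by omega)).1
      have hI : ∀ i, i + 1 = k → CanInsertOne n i := fun i hi => (ih i (by omega)).2
      exact ⟨canMakeShiftable_succ hn hk hI, canInsertOne_succ hn hk hI⟩

/-! ### Reachability of all valid sequences -/

/-- The initial state of the subset automaton. -/
def initialSeq (k : ℕ) : Set ℕ := if k = 0 then {0} else ∅

theorem reaches_of_singleton (hn : ∀ k, 3 ≤ n k) (q : ℕ) :
    ∀ S, ValidSeq n S → S 0 = {q} → (∀ j, 0 < j → S j = ∅) → Reaches n initialSeq S := by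
  induction q with
  | zero =>
    intro S _ h0 hj
    have : S = initialSeq := by
      funext j
      by_cases c : j = 0
      · subst c; simp [initialSeq, h0]
      · simp [initialSeq, c, hj j (by omega)]
    rw [this]
    exact .refl
  | succ q ih =>
    intro S hS h0 hj
    obtain ⟨hT, hr⟩ := shift_predecessor (C := S 2) hn hS (k := 0) (by simp [h0])
      (.inl (by simp [h0])) (by simp [hj]) (.inl rfl)
    refine (ih _ hT ?_ ?_).trans hr
    · ext x
      simp [h0]
    · intro j hj0
      by_cases c1 : j = 1
      · subst c1
        simp [replaceThree, hj, swapImage]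
      · by_cases c2 : j = 2
        · subst c2; simp [replaceThree, hj]
        · rw [replaceThree_of_lt (by omega), hj j hj0]

/-- The component after a fed one containing just `0` can be traced back to the empty set. -/
theorem exists_empty_of_fed (hn : ∀ k, 3 ≤ n k) {k : ℕ} (hS : ValidSeq n S) (hf : n k - 1 ∈ S k)
    (h0 : S (k + 1) = {0}) (h2 : ∀ j, k + 1 < j → S j = ∅) :
    ∃ T, ValidSeq n T ∧ (∀ j, k < j → T j = ∅) ∧ Reaches n T S := by
  have hk := hn k
  obtain ⟨S', hS', hg, hSj, hSk, hr⟩ :=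
    (canMakeShiftable_and_canInsertOne hn k).1 S hS (by simp [h0])
  have hb : n k ∉ S' k := fun h => lt_irrefl _ (hS'.bound _ _ h)
  -- Preparation keeps all elements that are at least `2`, hence the last state, since `n k ≥ 3`.
  have hl : n k - 1 ∈ S' k := (hSk _ (by omega)).2 hf
  have e1 : S' (k + 1) = {0} := (hSj _ (by omega)).trans h0
  have e2 : ∀ j, k + 1 < j → S' j = ∅ := fun j hj => (hSj j (by omega)).trans (h2 j hj)
  -- The `0` of component `k + 1` is attributed entirely to feeding, so its predecessor can be taken
  -- empty.
  have := cycle_predecessor hn hS' k (X := {t | t + 1 ∈ S' k}) (Y := ∅) (C := ∅)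
    (fun x hx => by have := hS'.bound _ _ hx; omega)
    (by rintro rfl; exact hg.singleton_shift hS')
    (hg.nonempty_shift ⟨_, hl⟩) (hg.mem_iff hn hS')
    (fun h => by
      rcases hg with h0 | ⟨h1, -⟩
      · exact absurd (hS'.fed h) h0
      · exact h1)
    (by simp) (by intro x; simp [e1, swapImage, hl])
    (by
      simp only [Set.mem_ofPred_eq]
      rw [show n k - 1 + 1 = n k by omega]
      exact fun h => absurd h hb)
    (by simp) (by simp)
    (by
      have := hn (k + 1)
      intro x
      simp [e1, e2, contractImage]
      omega)
    (by simp) (fun _ => e2 _ (by omega)) (by simp)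
  refine ⟨_, this.1, ?_, this.2.trans hr⟩
  intro j hj
  by_cases c1 : j = k + 1
  · subst c1; simp
  · by_cases c2 : j = k + 2
    · subst c2; simp
    · rw [replaceThree_of_lt (by omega), e2 j (by omega)]

/-- Going backwards, component `k + 1` passes from `{0}` to `{0, 1}`, then gets fed, and then shifts
down to `{0}` again while component `k` retains its last state. This reduces to
`exists_empty_of_fed`. -/
theorem exists_empty_of_eq_zero (hn : ∀ k, 3 ≤ n k) {k : ℕ} (hS : ValidSeq n S)
    (h0 : S (k + 1) = {0}) (h2 : ∀ j, k + 1 < j → S j = ∅) :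
    ∃ T, ValidSeq n T ∧ (∀ j, k < j → T j = ∅) ∧ Reaches n T S := by
  obtain ⟨T, hT, hTk, hTj, hr⟩ :=
    (canMakeShiftable_and_canInsertOne hn k).2 S hS (by simp [h0]) (by simp [h0])
  obtain ⟨U, hU, hUj, hl, hr'⟩ := exists_feed hn
    (fun i _ => (canMakeShiftable_and_canInsertOne hn i).2) hT (k := k) (by simp [hTk, h0])
    (by simp [hTk]) (by simp [hTj, h2])
  have e1 : U (k + 1) = {1, 0} := by rw [hUj _ (by omega), hTk, h0]
  have e2 : ∀ j, k + 1 < j → U j = ∅ := fun j hj => by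
    rw [hUj _ (by omega), hTj _ hj, h2 j hj]
  obtain ⟨hV, hr''⟩ := shift_predecessor (C := U (k + 3)) hn hU (k := k + 1) (by simp [e1])
    (.inr ⟨by simp [e1], hl⟩) (by simp [e2]) (.inl rfl)
  obtain ⟨W, hW, hWj, hr3⟩ := exists_empty_of_fed hn hV (k := k)
    (by rwa [replaceThree_below (by omega)])
    (by ext x; simp [e1])
    (by
      intro j hj
      by_cases c1 : j = k + 2
      · subst c1
        simp [replaceThree, e2, swapImage]
      · by_cases c2 : j = k + 3
        · subst c2; simp [replaceThree, e2]
        · rw [replaceThree_of_lt (by omega), e2 j hj])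
  exact ⟨W, hW, hWj, hr3.trans (hr''.trans (hr'.trans hr))⟩

theorem exists_shift_down (hn : ∀ k, 3 ≤ n k) {k : ℕ} (hS : ValidSeq n S)
    (hne : (S k).Nonempty) (hg : Shiftable n S k) (h2 : ∀ j, k < j → S j = ∅) :
    ∃ T, ValidSeq n T ∧ T k = {t | t + 1 ∈ S k} ∧ (∀ j, k < j → T j = ∅) ∧ Reaches n T S := by
  obtain ⟨hT, hr⟩ := shift_predecessor (C := S (k + 2)) hn hS hne hg (by simp [h2]) (.inl rfl)
  refine ⟨_, hT, by simp, ?_, hr⟩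
  intro j hj
  by_cases c1 : j = k + 1
  · subst c1
    simp [h2, swapImage]
  · by_cases c2 : j = k + 2
    · subst c2; simp [h2]
    · rw [replaceThree_of_lt (by omega), h2 j hj]

/-- Every valid sequence with finitely many nonempty components is reachable. -/
theorem reaches_of_validSeq (hn : ∀ k, 3 ≤ n k) (k : ℕ) :
    ∀ S, ValidSeq n S → (∀ j, k < j → S j = ∅) → Reaches n initialSeq S := by
  induction k with
  | zero =>
    intro S hS hj
    obtain ⟨q, hq⟩ := hS.singleton
    exact reaches_of_singleton hn q S hS hq hj
  | succ k ihk =>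
    have base : ∀ S, ValidSeq n S → S (k + 1) = ∅ → (∀ j, k + 1 < j → S j = ∅) →
        Reaches n initialSeq S := by
      intro S hS h0 hj
      refine ihk S hS fun j hj' => ?_
      by_cases c : j = k + 1
      · rw [c, h0]
      · exact hj j (by omega)
    have base0 : ∀ S, ValidSeq n S → S (k + 1) = {0} → (∀ j, k + 1 < j → S j = ∅) →
        Reaches n initialSeq S := by
      intro S hS h0 hj
      obtain ⟨T, hT, hTj, hr⟩ := exists_empty_of_eq_zero hn hS h0 hj
      exact (ihk T hT hTj).trans hr
    -- Induction on a bound for component `k + 1`. The bound starts at `2` because preparation may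
    -- alter `0` and `1`, but nothing larger.
    have step : ∀ m S, ValidSeq n S → (∀ j, k + 1 < j → S j = ∅) → (∀ x ∈ S (k + 1), x < m + 2) →
        Reaches n initialSeq S := by
      intro m
      induction m with
      | zero =>
        intro S hS hj hb
        have hb' : ∀ x ∈ S (k + 1), x = 0 ∨ x = 1 := fun x hx => by
          have := hb x hx
          omega
        by_cases h1 : 1 ∈ S (k + 1)
        · suffices ∃ T, ValidSeq n T ∧ T (k + 1) = S (k + 1) ∧ Shiftable n T (k + 1) ∧
              (∀ j, k + 1 < j → T j = ∅) ∧ Reaches n T S by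
            obtain ⟨T, hT, hTk, hg, hTj, hr⟩ := this
            obtain ⟨U, hU, hUk, hUj, hr'⟩ :=
              exists_shift_down hn hT (by rw [hTk]; exact ⟨1, h1⟩) hg hTj
            refine ((base0 U hU ?_ hUj).trans hr').trans hr
            rw [hUk, hTk]
            ext x
            simp only [Set.mem_ofPred_eq, Set.mem_singleton_iff]
            constructor
            · intro h
              have := hb _ h
              omega
            · rintro rfl
              exact h1
          by_cases h0 : 0 ∈ S (k + 1)
          · obtain ⟨T, hT, hTj, hl, hr⟩ := exists_feed hn
              (fun i _ => (canMakeShiftable_and_canInsertOne hn i).2) hS h0 h1 (by simp [hj])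
            exact ⟨T, hT, hTj _ (by omega), .inr ⟨by rwa [hTj _ (by omega)], hl⟩,
              fun j hj' => (hTj j (by omega)).trans (hj j hj'), hr⟩
          · exact ⟨S, hS, rfl, .inl h0, hj, .refl⟩
        · by_cases h0 : 0 ∈ S (k + 1)
          · refine base0 S hS ?_ hj
            ext x
            simp only [Set.mem_singleton_iff]
            constructor
            · intro h
              rcases hb' x h with rfl | rfl
              exacts [rfl, absurd h h1]
            · rintro rfl
              exact h0
          · refine base S hS ?_ hj
            ext x
            simp only [Set.mem_empty_iff_false, iff_false]
            intro h
            rcases hb' x h with rfl | rfl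
            exacts [h0 h, h1 h]
      | succ m ih =>
        intro S hS hj hb
        obtain ⟨T, hT, hg, hTj, hTk, hr⟩ :=
          (canMakeShiftable_and_canInsertOne hn (k + 1)).1 S hS (by simp [hj])
        have hTj' : ∀ j, k + 1 < j → T j = ∅ := fun j h => (hTj j h).trans (hj j h)
        by_cases hne : (T (k + 1)).Nonempty
        · obtain ⟨U, hU, hUk, hUj, hr'⟩ := exists_shift_down hn hT hne hg hTj'
          refine ((ih U hU hUj ?_).trans hr').trans hr
          rw [hUk]
          intro x hx
          by_cases c : x + 1 < 2
          · omega
          · have := hb _ ((hTk (x + 1) (by omega)).1 hx)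
            omega
        · exact (base T hT (Set.not_nonempty_iff_eq_empty.1 hne) hTj').trans hr
    intro S hS hj
    exact step (n (k + 1)) S hS hj fun x hx => by
      have := hS.bound _ _ hx
      omega

end MultiCatenation

/-! ### Distinguishing words -/

namespace MultiCatenation
variable {n : ℕ → ℕ} {S T : ℕ → Set ℕ}

/-- The state reached from `S` by reading the word `w`. -/
def subsetEval (n : ℕ → ℕ) (S : ℕ → Set ℕ) (w : List ℕ) : ℕ → Set ℕ :=
  w.foldl (fun S a => subsetStep n a S) S

theorem subsetEval_append (S : ℕ → Set ℕ) (v w : List ℕ) :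
    subsetEval n S (v ++ w) = subsetEval n (subsetEval n S v) w :=
  List.foldl_append

theorem subsetEval_replicate_succ (S : ℕ → Set ℕ) (t a : ℕ) :
    subsetEval n S (List.replicate (t + 1) a) =
      subsetStep n a (subsetEval n S (List.replicate t a)) := by
  rw [List.replicate_succ', subsetEval_append]
  rfl

theorem mem_subsetStep_of_pos {a k x : ℕ} (hx : x ≠ 0) :
    x ∈ subsetStep n a S k ↔ x ∈ letterImage n a k (S k) := by
  simp [subsetStep, hx]

theorem mem_rotate_of_mem {k q : ℕ} (hq : q ∈ S k) (t : ℕ) (ht : q + t < n k) :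
    q + t ∈ subsetEval n S (List.replicate t (k + 1)) k := by
  induction t with
  | zero => exact hq
  | succ t ih =>
    rw [subsetEval_replicate_succ, mem_subsetStep_of_pos (by omega), letterImage_cycle]
    exact .inr ⟨by omega, ht, ih (by omega)⟩

/-- Feeding inserts only `0`, which cannot catch up with the moving position `q + t`. -/
theorem mem_of_mem_rotate {k : ℕ} (t q : ℕ)
    (h : q + t ∈ subsetEval n S (List.replicate t (k + 1)) k) : q ∈ S k := by
  induction t with
  | zero => exact h
  | succ t ih =>
    rw [subsetEval_replicate_succ, mem_subsetStep_of_pos (by omega), letterImage_cycle] at h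
    rcases h with ⟨h, -⟩ | ⟨-, -, h⟩
    · omega
    · exact ih h

theorem last_mem_replicate {k : ℕ} (hn : ∀ k, 3 ≤ n k) (t : ℕ) :
    n k - 1 ∈ subsetEval n S (List.replicate t (k + 2)) k ↔ n k - 1 ∈ S k := by
  have := hn k
  induction t with
  | zero => rfl
  | succ t ih =>
    rw [subsetEval_replicate_succ, mem_subsetStep_of_pos (by omega),
      letterImage_other _ _ (by omega) (by omega) (by omega)]
    exact ih

theorem zero_mem_of_fed {k : ℕ} (hn : ∀ k, 3 ≤ n k) (h : n k - 1 ∈ S k) (t : ℕ) :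
    0 ∈ subsetEval n S (List.replicate (t + 1) (k + 2)) (k + 1) := by
  rw [subsetEval_replicate_succ]
  refine .inr ⟨rfl, ?_⟩
  change n k - 1 ∈ letterImage _ _ _ _
  rwa [letterImage_other _ _ (by omega) (by omega) (by omega), last_mem_replicate hn]

/-- The hole at `1` travels with the cycle; feeding can only fill position `0`. -/
theorem not_mem_of_not_fed {k : ℕ} (h1 : 1 ∉ S (k + 1)) (t : ℕ) :
    t + 1 ∉ subsetEval n S (List.replicate t (k + 2)) (k + 1) := by
  induction t with
  | zero => exact h1
  | succ t ih =>
    rw [subsetEval_replicate_succ, mem_subsetStep_of_pos (by omega), letterImage_cycle]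
    rintro (⟨h, -⟩ | ⟨-, -, h⟩)
    · omega
    · exact ih h

/-- After `n (k + 1) - 2` letters the hole is at the last state; the next letter moves it to `0`,
where only feeding could fill it. Letter `k + 2` fixes component `k`, so no feeding occurs. -/
theorem zero_not_mem_of_not_fed {k : ℕ} (hn : ∀ k, 3 ≤ n k) (h : n k - 1 ∉ S k)
    (h1 : 1 ∉ S (k + 1)) :
    0 ∉ subsetEval n S (List.replicate (n (k + 1) - 1) (k + 2)) (k + 1) := by
  obtain ⟨t, ht⟩ : ∃ t, n (k + 1) = t + 2 := ⟨n (k + 1) - 2, by have := hn (k + 1); omega⟩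
  rw [ht, show t + 2 - 1 = t + 1 by omega, subsetEval_replicate_succ]
  rintro (h' | ⟨-, h'⟩)
  · rw [letterImage_cycle] at h'
    rcases h' with ⟨-, h'⟩ | ⟨h', -⟩
    · rw [ht] at h'
      exact not_mem_of_not_fed h1 t h'
    · omega
  · change n k - 1 ∈ letterImage _ _ _ _ at h'
    rw [letterImage_other _ _ (by omega) (by omega) (by omega), last_mem_replicate hn] at h'
    exact h h'

/-- States differing in the `k`-th component are distinguished by a word. -/
theorem exists_distinguishing (hn : ∀ k, 3 ≤ n k) {α : ℕ} (d : ℕ) :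
    ∀ (k q : ℕ) (S T : ℕ → Set ℕ), k + d + 1 = α → q < n k → q ∈ S k → q ∉ T k →
      ∃ w : List ℕ, (∀ a ∈ w, a ≤ α) ∧ n (α - 1) - 1 ∈ subsetEval n S w (α - 1) ∧
        n (α - 1) - 1 ∉ subsetEval n T w (α - 1) := by
  have rot : ∀ (k q : ℕ) (S T : ℕ → Set ℕ), q < n k → q ∈ S k → q ∉ T k →
      n k - 1 ∈ subsetEval n S (List.replicate (n k - 1 - q) (k + 1)) k ∧
        n k - 1 ∉ subsetEval n T (List.replicate (n k - 1 - q) (k + 1)) k := by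
    intro k q S T hq hS hT
    have h1 := mem_rotate_of_mem (n := n) hS (n k - 1 - q) (by omega)
    have h2 := mt (mem_of_mem_rotate (n := n) (n k - 1 - q) q) hT
    rw [show q + (n k - 1 - q) = n k - 1 by omega] at h1 h2
    exact ⟨h1, h2⟩
  induction d with
  | zero =>
    intro k q S T hk hq hS hT
    obtain rfl : k = α - 1 := by omega
    obtain ⟨h1, h2⟩ := rot _ q S T hq hS hT
    refine ⟨_, fun a ha => ?_, h1, h2⟩
    rw [List.eq_of_mem_replicate ha]
    omega
  | succ d ih =>
    intro k q S T hk hq hS hT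
    have hk3 := hn k
    have hk3' := hn (k + 1)
    obtain ⟨h1, h2⟩ := rot k q S T hq hS hT
    set S₁ := subsetEval n S (List.replicate (n k - 1 - q) (k + 1))
    set T₁ := subsetEval n T (List.replicate (n k - 1 - q) (k + 1))
    -- Letter `k` makes the hole at `1` in component `k + 1` by contraction, while its transposition
    -- on component `k` fixes the last state.
    have h3 : n k - 1 ∈ subsetStep n k S₁ k := by
      rwa [mem_subsetStep_of_pos (by omega), letterImage_swap, last_mem_swapImage hk3]
    have h4 : n k - 1 ∉ subsetStep n k T₁ k := by
      rwa [mem_subsetStep_of_pos (by omega), letterImage_swap, last_mem_swapImage hk3]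
    have h5 : 1 ∉ subsetStep n k T₁ (k + 1) := by
      rw [mem_subsetStep_of_pos (by omega), letterImage_contract]
      exact fun h => h.1 rfl
    have h6 := zero_mem_of_fed hn h3 (n (k + 1) - 2)
    have h7 := zero_not_mem_of_not_fed hn h4 h5
    rw [show n (k + 1) - 2 + 1 = n (k + 1) - 1 by omega] at h6
    obtain ⟨w, hw, h8, h9⟩ := ih (k + 1) 0 _ _ (by omega) (by omega) h6 h7
    refine ⟨List.replicate (n k - 1 - q) (k + 1) ++ [k] ++
      List.replicate (n (k + 1) - 1) (k + 2) ++ w, ?_, ?_, ?_⟩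
    · intro a ha
      simp only [List.mem_append, List.mem_replicate, List.mem_singleton] at ha
      rcases ha with ((ha | ha) | ha) | ha
      · omega
      · omega
      · omega
      · exact hw a ha
    · rw [subsetEval_append, subsetEval_append, subsetEval_append]
      exact h8
    · rw [subsetEval_append, subsetEval_append, subsetEval_append]
      exact h9

end MultiCatenation

/-! ### The upper bound for arbitrary automata -/

namespace MultiCatenation
variable {Γ : Type*} {α : ℕ}

theorem stateComplexity_le {m : ℕ} {L : Language Γ} (M : DFA Γ (Fin m)) (h : M.accepts = L) :
    stateComplexity L ≤ m :=
  Nat.sInf_le ⟨M, h⟩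

theorem exists_dfa_of_isRegular {L : Language Γ} (h : L.IsRegular) :
    ∃ M : DFA Γ (Fin (stateComplexity L)), M.accepts = L := by
  obtain ⟨σ, _, M, hM⟩ := h
  have hne : {m : ℕ | ∃ M : DFA Γ (Fin m), M.accepts = L}.Nonempty :=
    ⟨Fintype.card σ, DFA.reindex (Fintype.equivFin σ) M, by simpa using hM⟩
  exact Nat.sInf_mem hne

/-- If an invariant of words with values in a finite set determines membership in `L` and is
compatible with appending letters, some automaton for `L` has at most as many states as there are
values. -/
theorem exists_dfa_le_ncard {X : Type*} {L : Language Γ} {V : Set X} (hV : V.Finite)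
    (f : List Γ → X) (hf : ∀ w, f w ∈ V)
    (hstep : ∀ w w' a, f w = f w' → f (w ++ [a]) = f (w' ++ [a]))
    (hacc : ∀ w w', f w = f w' → (w ∈ L ↔ w' ∈ L)) :
    ∃ m ≤ V.ncard, ∃ M : DFA Γ (Fin m), M.accepts = L := by
  have happ : ∀ v w w', f w = f w' → f (w ++ v) = f (w' ++ v) := by
    intro v
    induction v using List.reverseRecOn with
    | nil => simp
    | append_singleton v a ih =>
      intro w w' h
      rw [← List.append_assoc, ← List.append_assoc]
      exact hstep _ _ _ (ih w w' h)
  have hquot : ∀ w w', f w = f w' → L.leftQuotient w = L.leftQuotient w' := by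
    intro w w' h
    ext v
    exact hacc _ _ (happ v w w' h)
  have hfin : Finite V := hV
  -- The left quotient by `w` depends only on `f w`, so `V` indexes all states of the Myhill–Nerode
  -- automaton.
  let g : V → Language Γ := fun x => L.leftQuotient (Function.invFun f x)
  have hrange : Set.range L.leftQuotient ⊆ Set.range g := by
    rintro _ ⟨w, rfl⟩
    exact ⟨⟨f w, hf w⟩, hquot _ _ (Function.invFun_eq ⟨w, rfl⟩)⟩
  have hgfin : (Set.range g).Finite := Set.finite_range g
  have : Finite (Set.range L.leftQuotient) := hgfin.subset hrange
  refine ⟨Nat.card (Set.range L.leftQuotient), ?_,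
    DFA.reindex (Finite.equivFin _) L.toDFA,
    (DFA.accepts_reindex _ _).trans L.accepts_toDFA⟩
  calc Nat.card (Set.range L.leftQuotient)
    _ ≤ Nat.card (Set.range g) := Nat.card_mono hgfin hrange
    _ ≤ Nat.card V := Finite.card_range_le g
    _ = V.ncard := rfl

/-- The product of the first `k` of the languages. -/
def prefixProduct (L : Fin α → Language Γ) (k : ℕ) : Language Γ := ((List.ofFn L).take k).prod

theorem prefixProduct_zero (L : Fin α → Language Γ) : prefixProduct L 0 = 1 := rfl

theorem prefixProduct_succ (L : Fin α → Language Γ) {k : ℕ} (hk : k < α) :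
    prefixProduct L (k + 1) = prefixProduct L k * L ⟨k, hk⟩ := by
  unfold prefixProduct
  rw [List.take_succ_eq_append_getElem (by simpa using hk), List.prod_append]
  simp

theorem prefixProduct_self (L : Fin α → Language Γ) : prefixProduct L α = catenation L := by
  unfold prefixProduct catenation
  rw [List.take_of_length_le (by simp)]

variable {Q : Fin α → Type*} (B : (k : Fin α) → DFA Γ (Q k))

/-- The states of the `k`-th automaton reached by a run on some suffix of `w`, started after a
prefix belonging to the product of the preceding languages. -/
def reached (w : List Γ) (k : Fin α) : Set (Q k) :=
  {q | ∃ u v, u ++ v = w ∧ u ∈ prefixProduct (fun k => (B k).accepts) k ∧ (B k).eval v = q}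

variable {B}

theorem mem_prefixProduct_succ {w : List Γ} {k : ℕ} (hk : k < α) :
    w ∈ prefixProduct (fun k => (B k).accepts) (k + 1) ↔
      (reached B w ⟨k, hk⟩ ∩ (B ⟨k, hk⟩).accept).Nonempty := by
  rw [prefixProduct_succ _ hk, Language.mem_mul]
  constructor
  · rintro ⟨u, hu, v, hv, rfl⟩
    exact ⟨_, ⟨u, v, rfl, hu, rfl⟩, hv⟩
  · rintro ⟨_, ⟨u, v, rfl, hu, rfl⟩, hv⟩
    exact ⟨u, hu, v, hv, rfl⟩

theorem mem_reached_nil {k : Fin α} {q : Q k} :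
    q ∈ reached B [] k ↔ q = (B k).start ∧ [] ∈ prefixProduct (fun k => (B k).accepts) k := by
  constructor
  · rintro ⟨u, v, h, hu, rfl⟩
    obtain ⟨rfl, rfl⟩ := List.append_eq_nil_iff.1 h
    exact ⟨rfl, hu⟩
  · rintro ⟨rfl, h⟩
    exact ⟨[], [], rfl, h, rfl⟩

theorem mem_reached_append_singleton {w : List Γ} {a : Γ} {k : Fin α} {q : Q k} :
    q ∈ reached B (w ++ [a]) k ↔ (∃ p ∈ reached B w k, (B k).step p a = q) ∨
      q = (B k).start ∧ w ++ [a] ∈ prefixProduct (fun k => (B k).accepts) k := by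
  constructor
  · rintro ⟨u, v, h, hu, rfl⟩
    rcases List.eq_nil_or_concat v with rfl | ⟨v, b, rfl⟩
    · rw [List.append_nil] at h
      exact .inr ⟨rfl, h ▸ hu⟩
    · rw [List.concat_eq_append] at h ⊢
      rw [← List.append_assoc] at h
      obtain ⟨rfl, h'⟩ := List.append_inj' h rfl
      obtain rfl : b = a := by simpa using h'
      exact .inl ⟨_, ⟨u, v, rfl, hu, rfl⟩, by simp⟩
  · rintro (⟨_, ⟨u, v, rfl, hu, rfl⟩, rfl⟩ | ⟨rfl, h⟩)
    · exact ⟨u, v ++ [a], by simp, hu, by simp⟩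
    · exact ⟨_, [], by simp, h, rfl⟩

theorem isValid_reached (w : List Γ) : IsValid B (reached B w) where
  singleton k hk := by
    refine ⟨(B k).eval w, ?_⟩
    ext q
    constructor
    · rintro ⟨u, v, rfl, hu, rfl⟩
      rw [hk, prefixProduct_zero, Language.mem_one] at hu
      simp [hu]
    · rintro rfl
      exact ⟨[], w, rfl, by rw [hk]; rfl, rfl⟩
  empty j k hjk h := by
    ext q
    simp only [Set.mem_empty_iff_false, iff_false]
    rintro ⟨u, v, rfl, hu, rfl⟩
    rw [hjk, prefixProduct_succ _ j.2, Language.mem_mul] at hu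
    obtain ⟨u, hu, u', -, rfl⟩ := hu
    have : (B j).eval (u' ++ v) ∈ reached B (u ++ u' ++ v) j := ⟨u, u' ++ v, by simp, hu, rfl⟩
    rw [h] at this
    exact this
  final j k hjk h := by
    refine ⟨w, [], by simp, ?_, rfl⟩
    rw [hjk]
    exact (mem_prefixProduct_succ j.2).2 h

/-- Whether `0`-runs start in component `k + 1` depends on component `k` after the letter has been
read, so components are compared in increasing order. -/
theorem reached_congr {w w' : List Γ} (h : reached B w = reached B w') (a : Γ) :
    reached B (w ++ [a]) = reached B (w' ++ [a]) := by
  have key : ∀ k : ℕ, ∀ hk : k < α,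
      (w ++ [a] ∈ prefixProduct (fun k => (B k).accepts) k ↔
        w' ++ [a] ∈ prefixProduct (fun k => (B k).accepts) k) ∧
      reached B (w ++ [a]) ⟨k, hk⟩ = reached B (w' ++ [a]) ⟨k, hk⟩ := by
    intro k
    induction k with
    | zero =>
      intro hk
      have h0 : ∀ w : List Γ, ¬ w ++ [a] ∈ prefixProduct (fun k => (B k).accepts) 0 := by
        intro w
        rw [prefixProduct_zero, Language.mem_one]
        simp
      refine ⟨by simp [h0], ?_⟩
      ext q
      rw [mem_reached_append_singleton, mem_reached_append_singleton, h]
      simp [h0]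
    | succ k ih =>
      intro hk
      have h0 := (ih (by omega)).2
      have h1 : w ++ [a] ∈ prefixProduct (fun k => (B k).accepts) (k + 1) ↔
          w' ++ [a] ∈ prefixProduct (fun k => (B k).accepts) (k + 1) := by
        rw [mem_prefixProduct_succ (by omega), mem_prefixProduct_succ (by omega), h0]
      refine ⟨h1, ?_⟩
      ext q
      rw [mem_reached_append_singleton, mem_reached_append_singleton, h]
      simp only [h1]
  funext k
  exact (key k k.2).2

theorem mem_catenation_iff (hα : 0 < α) {w : List Γ} :
    w ∈ catenation (fun k => (B k).accepts) ↔
      (reached B w ⟨α - 1, by omega⟩ ∩ (B ⟨α - 1, by omega⟩).accept).Nonempty := by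
  rw [← mem_prefixProduct_succ, show α - 1 + 1 = α by omega, prefixProduct_self]

theorem exists_dfa_catenation (hα : 0 < α) [∀ k, Finite (Q k)] :
    ∃ m ≤ {S : (k : Fin α) → Set (Q k) | IsValid B S}.ncard,
      ∃ M : DFA Γ (Fin m), M.accepts = catenation fun k => (B k).accepts :=
  exists_dfa_le_ncard (Set.toFinite _) (reached B) isValid_reached
    (fun _ _ a h => reached_congr h a)
    (fun _ _ h => by rw [mem_catenation_iff hα, mem_catenation_iff hα, h])

theorem stateComplexity_catenation_le (hα : 0 < α) [∀ k, Finite (Q k)] :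
    stateComplexity (catenation fun k => (B k).accepts) ≤
      {S : (k : Fin α) → Set (Q k) | IsValid B S}.ncard := by
  obtain ⟨m, hm, M, hM⟩ := exists_dfa_catenation (B := B) hα
  exact (stateComplexity_le M hM).trans hm

end MultiCatenation

/-! ### Maximizing the number of valid sequences -/

namespace MultiCatenation
variable {Γ : Type*} {α : ℕ}

theorem exists_perm_accept {m : ℕ} (F : Set (Fin m)) (hF : F.Nonempty) (l : Fin m) :
    ∃ e : Equiv.Perm (Fin m), ∀ s, e s = l → s ∈ F := by
  obtain ⟨f, hf⟩ := hF
  refine ⟨Equiv.swap f l, fun s hs => ?_⟩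
  rwa [(Equiv.swap f l).injective (hs.trans (Equiv.swap_apply_left f l).symm)]

/-- Both `i ↦ z` and `f ↦ l` with `f ∈ F` can be prescribed only if `i ≠ f`. When `i ∈ F` the second
demand is dropped, as a forced component then contains the final state `i` anyway. -/
theorem exists_perm_start_accept {m : ℕ} (F : Set (Fin m)) (hF : F.Nonempty) (i z l : Fin m)
    (hzl : z ≠ l) : ∃ e : Equiv.Perm (Fin m), e i = z ∧ (i ∉ F → ∀ s, e s = l → s ∈ F) := by
  by_cases hi : i ∈ F
  · exact ⟨Equiv.swap i z, by simp, fun h => absurd hi h⟩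
  · obtain ⟨f, hf⟩ := hF
    have hfi : i ≠ f := by rintro rfl; exact hi hf
    have hz : z ≠ Equiv.swap i z f := by
      intro h
      apply hfi
      apply (Equiv.swap i z).injective
      rw [← h, Equiv.swap_apply_left]
    refine ⟨(Equiv.swap i z).trans (Equiv.swap (Equiv.swap i z f) l), ?_, fun _ s hs => ?_⟩
    · simp [Equiv.swap_apply_of_ne_of_ne hz hzl]
    · have h : ((Equiv.swap i z).trans (Equiv.swap (Equiv.swap i z f) l)) f = l := by simp
      rwa [Equiv.injective _ (hs.trans h.symm)]

/-- The component preceding the `k`-th one contains a final state. -/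
def Forced {Q : Fin α → Type*} (B : (k : Fin α) → DFA Γ (Q k)) (S : (k : Fin α) → Set (Q k))
    (k : Fin α) : Prop :=
  ∃ j : Fin α, (k : ℕ) = j + 1 ∧ (S j ∩ (B j).accept).Nonempty

/-- The number of valid sequences is maximal when every automaton has a unique final state, which
differs from the initial state. -/
theorem ncard_isValid_le {Δ : Type*} {n : Fin α → ℕ} (A : (k : Fin α) → DFA Γ (Fin (n k)))
    (l : (k : Fin α) → Fin (n k)) (hAl : ∀ k, (A k).accept = {l k})
    (hA : ∀ k, (A k).start ≠ l k) (B : (k : Fin α) → DFA Δ (Fin (n k)))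
    (hB : ∀ k, (B k).accept.Nonempty) :
    {S : (k : Fin α) → Set (Fin (n k)) | IsValid B S}.ncard ≤
      {S : (k : Fin α) → Set (Fin (n k)) | IsValid A S}.ncard := by
  classical
  choose e he using fun k => exists_perm_accept (B k).accept (hB k) (l k)
  choose e' he' he'' using fun k =>
    exists_perm_start_accept (B k).accept (hB k) (B k).start (A k).start (l k) (hA k)
  -- Forced components must have their initial state carried to that of `A`; the others only need `l
  -- k` to come from a final state of `B`.
  let p : ((k : Fin α) → Set (Fin (n k))) → (k : Fin α) → Equiv.Perm (Fin (n k)) :=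
    fun S k => if Forced B S k then e' k else e k
  refine Set.ncard_le_ncard_of_injOn (fun S k => p S k '' S k) ?_ ?_ (Set.toFinite _)
  · intro S hS
    refine ⟨?_, ?_, ?_⟩
    · intro k hk
      obtain ⟨q, hq⟩ := hS.singleton k hk
      exact ⟨p S k q, by simp [hq]⟩
    · intro j k hjk h
      have := hS.empty j k hjk (Set.image_eq_empty.1 h)
      simp [this]
    · intro j k hjk h
      rw [hAl] at h
      obtain ⟨_, ⟨s, hs, rfl⟩, hsl⟩ := h
      have hsl : p S j s = l j := hsl
      have hmeet : (S j ∩ (B j).accept).Nonempty := by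
        by_cases hf : Forced B S j
        · simp only [p, if_pos hf] at hsl
          by_cases hi : (B j).start ∈ (B j).accept
          · obtain ⟨i, hi', hm⟩ := hf
            exact ⟨_, hS.final i j hi' hm, hi⟩
          · exact ⟨s, hs, he'' j hi s hsl⟩
        · simp only [p, if_neg hf] at hsl
          exact ⟨s, hs, he j s hsl⟩
      have hf : Forced B S k := ⟨j, hjk, hmeet⟩
      refine ⟨(B k).start, hS.final j k hjk hmeet, ?_⟩
      simp only [p, if_pos hf]
      exact he' k
  · intro S _ T _ hST
    -- Whether component `k + 1` is forced depends only on component `k`, so the permutations, and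
    -- then the sets, are recovered one by one.
    have key : ∀ k : ℕ, ∀ hk : k < α, S ⟨k, hk⟩ = T ⟨k, hk⟩ := by
      intro k
      induction k with
      | zero =>
        intro hk
        have hp : ∀ S : (k : Fin α) → Set (Fin (n k)), ¬ Forced B S ⟨0, hk⟩ := by
          rintro S ⟨j, hj, -⟩
          simp at hj
        have h : p S ⟨0, hk⟩ '' S ⟨0, hk⟩ = p T ⟨0, hk⟩ '' T ⟨0, hk⟩ := congrFun hST _
        simp only [p, if_neg (hp _)] at h
        exact (Equiv.injective _).image_injective h
      | succ k ih =>
        intro hk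
        have hp : Forced B S ⟨k + 1, hk⟩ ↔ Forced B T ⟨k + 1, hk⟩ := by
          have hk' := ih (by omega)
          constructor
          · rintro ⟨⟨j, hj'⟩, hj, h⟩
            obtain rfl : k = j := by simpa using hj
            exact ⟨_, hj, hk' ▸ h⟩
          · rintro ⟨⟨j, hj'⟩, hj, h⟩
            obtain rfl : k = j := by simpa using hj
            exact ⟨_, hj, hk'.symm ▸ h⟩
        have h : p S ⟨k + 1, hk⟩ '' S ⟨k + 1, hk⟩ = p T ⟨k + 1, hk⟩ '' T ⟨k + 1, hk⟩ :=
          congrFun hST _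
        simp only [p, hp] at h
        exact (Equiv.injective _).image_injective h
    funext k
    exact key k k.2

end MultiCatenation

/-! ### Transfer to the witness automata -/

namespace MultiCatenation

section Witness

variable {α : ℕ} {n : Fin α → ℕ}

/-- The sizes `n`, extended by `3`. -/
def extendSize (n : Fin α → ℕ) (k : ℕ) : ℕ := if h : k < α then n ⟨k, h⟩ else 3

theorem extendSize_apply (k : Fin α) : extendSize n k = n k := by
  simp [extendSize]

theorem three_le_extendSize (hn : ∀ k, 3 ≤ n k) (k : ℕ) : 3 ≤ extendSize n k := by
  unfold extendSize
  split_ifs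
  exacts [hn _, le_rfl]

/-- The family of witness automata. -/
def witness (hn : ∀ k, 3 ≤ n k) (k : Fin α) : DFA (Fin (α + 1)) (Fin (n k)) :=
  witnessDFA k (n k) (le_trans (by norm_num) (hn k))

variable {hn : ∀ k, 3 ≤ n k}

theorem mem_letterImage_iff {k : Fin α} (a : Fin (α + 1)) (X : Set ℕ) (q : Fin (n k)) :
    (∃ p : Fin (n k), (p : ℕ) ∈ X ∧ (witness hn k).step p a = q) ↔
      (q : ℕ) ∈ letterImage (extendSize n) a k X := by
  have h3 := hn k
  obtain ⟨q, hq⟩ := q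
  simp only [witness, witnessDFA, letterImage, extendSize_apply]
  split_ifs with c1 c2 c3
  · simp only [contraction, contractImage, Set.mem_ofPred_eq, Function.update_apply, id]
    constructor
    · rintro ⟨p, hp, h⟩
      split_ifs at h with hp1
      · subst hp1
        simp only [Fin.mk.injEq] at h
        subst h
        exact ⟨by omega, .inr ⟨rfl, hp⟩⟩
      · subst h
        refine ⟨fun h => hp1 (Fin.ext h), .inl hp⟩
    · rintro ⟨h1, h | ⟨rfl, h⟩⟩
      · refine ⟨⟨q, hq⟩, h, ?_⟩
        rw [if_neg]
        simpa using h1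
      · exact ⟨⟨1, by omega⟩, h, by simp⟩
  · simp only [transposition, swapImage, Set.mem_ofPred_eq]
    constructor
    · rintro ⟨p, hp, h⟩
      rw [Equiv.swap_apply_def] at h
      split_ifs at h with hp0 hp1
      · subst hp0
        simp only [Fin.mk.injEq] at h
        exact .inr (.inl ⟨h.symm, hp⟩)
      · subst hp1
        simp only [Fin.mk.injEq] at h
        exact .inl ⟨h.symm, hp⟩
      · subst h
        simp only [Fin.ext_iff] at hp0 hp1
        exact .inr (.inr ⟨by omega, hp⟩)
    · rintro (⟨rfl, h⟩ | ⟨rfl, h⟩ | ⟨h2, h⟩)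
      · exact ⟨⟨1, by omega⟩, h, by simp⟩
      · exact ⟨⟨0, by omega⟩, h, by simp⟩
      · refine ⟨⟨q, hq⟩, h, Equiv.swap_apply_of_ne_of_ne ?_ ?_⟩
        · simp; omega
        · simp; omega
  · simp only [cycle, cycleImage, Set.mem_ofPred_eq]
    obtain ⟨m, hm⟩ : ∃ m, n k = m + 1 := ⟨n k - 1, by omega⟩
    generalize n k = l at *
    subst hm
    constructor
    · rintro ⟨p, hp, h⟩
      have hv := congrArg Fin.val h
      by_cases hpl : p = Fin.last m
      · subst hpl
        simp at hv
        exact .inl ⟨hv.symm, by simpa using hp⟩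
      · have hlt : (p : ℕ) < m := Fin.val_lt_last hpl
        rw [coe_finRotate_of_ne_last hpl] at hv
        simp only at hv
        subst hv
        exact .inr ⟨by omega, by omega, by simpa using hp⟩
    · rintro (⟨rfl, h⟩ | ⟨h1, h2, h⟩)
      · exact ⟨Fin.last m, by simpa using h, by simp⟩
      · refine ⟨⟨q - 1, by omega⟩, h, ?_⟩
        apply Fin.ext
        rw [coe_finRotate_of_ne_last]
        · simp; omega
        · simp [Fin.ext_iff]; omega
  · constructor
    · rintro ⟨p, hp, rfl⟩
      exact hp
    · intro h
      exact ⟨_, h, rfl⟩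

/-- The unique final state. -/
def lastState (hn : ∀ k, 3 ≤ n k) (k : Fin α) : Fin (n k) :=
  ⟨n k - 1, by have := hn k; omega⟩

theorem accept_witness (k : Fin α) : (witness hn k).accept = {lastState hn k} := rfl

theorem start_ne_lastState (k : Fin α) : (witness hn k).start ≠ lastState hn k := by
  have := hn k
  simp only [witness, witnessDFA, lastState, ne_eq, Fin.mk.injEq]
  omega

theorem inter_accept_nonempty {k : Fin α} {X : Set (Fin (n k))} :
    (X ∩ (witness hn k).accept).Nonempty ↔ lastState hn k ∈ X := by
  rw [accept_witness, Set.inter_singleton_nonempty]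

theorem mem_reached_iff (w : List (Fin (α + 1))) :
    ∀ (k : Fin α) (q : Fin (n k)), q ∈ reached (witness hn) w k ↔
      (q : ℕ) ∈ subsetEval (extendSize n) initialSeq (w.map Fin.val) k := by
  induction w using List.reverseRecOn with
  | nil =>
    rintro ⟨k, hk⟩ q
    change _ ↔ (q : ℕ) ∈ initialSeq k
    rw [mem_reached_nil]
    cases k with
    | zero =>
      simp only [initialSeq, if_true, Set.mem_singleton_iff, prefixProduct_zero]
      refine ⟨fun h => by rw [h.1]; rfl, fun h => ⟨Fin.ext h, rfl⟩⟩
    | succ k =>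
      rw [mem_prefixProduct_succ (by omega), inter_accept_nonempty, mem_reached_nil]
      simp [initialSeq, (start_ne_lastState _).symm]
  | append_singleton w a ih =>
    have himg : ∀ (k : Fin α) (q : Fin (n k)),
        (∃ p ∈ reached (witness hn) w k, (witness hn k).step p a = q) ↔
          (q : ℕ) ∈ letterImage (extendSize n) a k
            (subsetEval (extendSize n) initialSeq (w.map Fin.val) k) := by
      intro k q
      rw [← mem_letterImage_iff (hn := hn)]
      simp only [ih]
    rintro ⟨k, hk⟩ q
    rw [mem_reached_append_singleton, List.map_append, subsetEval_append, himg]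
    change _ ↔ (q : ℕ) ∈ subsetStep _ _ _ _
    simp only [subsetStep, Set.mem_ofPred_eq]
    refine or_congr .rfl (and_congr ?_ ?_)
    · rw [Fin.ext_iff]
      rfl
    · cases k with
      | zero =>
        rw [prefixProduct_zero, Language.mem_one]
        simp [Fed]
      | succ k =>
        rw [mem_prefixProduct_succ (by omega), inter_accept_nonempty,
          mem_reached_append_singleton, himg]
        have hne := (start_ne_lastState (hn := hn) ⟨k, by omega⟩).symm
        have : extendSize n k = n ⟨k, by omega⟩ := extendSize_apply ⟨k, by omega⟩
        simp only [hne, false_and, or_false, Fed, this]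
        rfl

theorem exists_map_val (v : List ℕ) (hv : ∀ a ∈ v, a ≤ α) :
    ∃ w : List (Fin (α + 1)), w.map Fin.val = v := by
  induction v with
  | nil => exact ⟨[], rfl⟩
  | cons a v ih =>
    obtain ⟨w, rfl⟩ := ih fun b hb => hv b (List.mem_cons_of_mem _ hb)
    exact ⟨⟨a, Nat.lt_succ_of_le (hv a List.mem_cons_self)⟩ :: w, rfl⟩

/-- A letter above `α` acts as the identity on the first `α` components, so it is dropped. Feeding
adds nothing in such a step because fed components already contain `0`; this invariant is carried
through the induction. -/
theorem exists_word_of_reaches {N : ℕ → ℕ} (hN : ∀ k, 3 ≤ N k) {T : ℕ → Set ℕ}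
    (hT : Reaches N initialSeq T) :
    (∀ k, Fed N T k → 0 ∈ T k) ∧ ∃ w : List (Fin (α + 1)),
      ∀ k < α, subsetEval N initialSeq (w.map Fin.val) k = T k := by
  have sub_congr : ∀ (a : ℕ) (S T : ℕ → Set ℕ), (∀ k < α, S k = T k) →
      ∀ k < α, subsetStep N a S k = subsetStep N a T k := by
    intro a S T h k hk
    have hf : Fed N (fun j => letterImage N a j (S j)) k ↔
        Fed N (fun j => letterImage N a j (T j)) k :=
      fed_congr fun j hj => by rw [h j (by omega)]
    simp only [subsetStep, hf, h k hk]
  induction hT with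
  | refl =>
    refine ⟨?_, [], fun k _ => rfl⟩
    rintro (_ | _ | k) h
    · exact h.elim
    · have := hN 0
      simp [Fed, initialSeq] at h
      omega
    · simp [Fed, initialSeq] at h
  | @tail U _ _ hstep ih =>
    obtain ⟨a, rfl⟩ := hstep
    obtain ⟨hfed, w, hw⟩ := ih
    constructor
    · intro k h
      refine .inr ⟨rfl, ?_⟩
      refine (fed_congr fun j _ => ?_).1 h
      have := hN j
      exact mem_subsetStep_of_pos (by omega)
    · by_cases ha : a ≤ α
      · refine ⟨w ++ [⟨a, by omega⟩], fun k hk => ?_⟩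
        rw [List.map_append, subsetEval_append]
        exact sub_congr a _ _ hw k hk
      · refine ⟨w, fun k hk => ?_⟩
        rw [hw k hk]
        ext x
        have hf := fed_congr (n := N) (k := k) (S := U)
          (T := fun j => letterImage N a j (U j))
          fun j hj => by rw [letterImage_other _ _ (by omega) (by omega) (by omega)]
        simp only [subsetStep, Set.mem_ofPred_eq, ← hf]
        rw [letterImage_other _ _ (by omega) (by omega) (by omega)]
        exact ⟨.inl, fun h => h.elim id fun ⟨h, h'⟩ => h ▸ hfed k h'⟩

/-- A valid sequence, extended to infinitely many components. -/
def extendSeq (S : (k : Fin α) → Set (Fin (n k))) (k : ℕ) : Set ℕ :=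
  if h : k < α then Fin.val '' S ⟨k, h⟩
  else {x | x = 0 ∧ ∃ j : Fin α, k = j + 1 ∧ n j - 1 ∈ Fin.val '' S j}

theorem extendSeq_apply (S : (k : Fin α) → Set (Fin (n k))) {k : ℕ} (h : k < α) :
    extendSeq S k = Fin.val '' S ⟨k, h⟩ := by
  simp [extendSeq, h]

theorem last_mem_image {k : Fin α} {X : Set (Fin (n k))} :
    n k - 1 ∈ Fin.val '' X ↔ lastState hn k ∈ X := by
  constructor
  · rintro ⟨x, hx, h⟩
    obtain rfl : x = lastState hn k := Fin.ext h
    exact hx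
  · intro h
    exact ⟨_, h, rfl⟩

theorem extendSeq_eq_empty (S : (k : Fin α) → Set (Fin (n k))) {k : ℕ} (h : α < k) :
    extendSeq S k = ∅ := by
  simp only [extendSeq, show ¬ k < α by omega, dif_neg, not_false_eq_true]
  ext x
  simp only [Set.mem_ofPred_eq, Set.mem_empty_iff_false, iff_false]
  rintro ⟨-, j, hj, -⟩
  omega

/-- Component `α` of the extension has to be `{0}` when the last given component contains its final
state. The state `0` feeds nothing further, so the rest can be empty. -/
theorem validSeq_extendSeq (hα : 0 < α) {S : (k : Fin α) → Set (Fin (n k))}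
    (hS : IsValid (witness hn) S) : ValidSeq (extendSize n) (extendSeq S) where
  bound k x hx := by
    by_cases h : k < α
    · rw [extendSeq_apply S h] at hx
      obtain ⟨x, -, rfl⟩ := hx
      exact (extendSize_apply (n := n) ⟨k, h⟩).symm ▸ x.2
    · simp only [extendSeq, h, dif_neg, not_false_eq_true] at hx
      have := three_le_extendSize hn k
      have := hx.1
      omega
  singleton := by
    obtain ⟨q, hq⟩ := hS.singleton ⟨0, hα⟩ rfl
    exact ⟨q, by rw [extendSeq_apply S hα, hq, Set.image_singleton]⟩
  empty k h := by
    by_cases hk : k + 1 < α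
    · rw [extendSeq_apply S hk, hS.empty ⟨k, by omega⟩ _ rfl, Set.image_empty]
      rwa [extendSeq_apply S (by omega), Set.image_eq_empty] at h
    · simp only [extendSeq, hk, dif_neg, not_false_eq_true]
      ext x
      simp only [Set.mem_ofPred_eq, Set.mem_empty_iff_false, iff_false]
      rintro ⟨-, j, hj, hl⟩
      obtain rfl : k = j := by omega
      rw [extendSeq_apply S j.2] at h
      simp [h] at hl
  final k h := by
    by_cases hk : k < α
    · have hl : n ⟨k, hk⟩ - 1 ∈ Fin.val '' S ⟨k, hk⟩ := by
        rwa [extendSeq_apply S hk,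
          show extendSize n k = n ⟨k, hk⟩ from extendSize_apply ⟨k, hk⟩] at h
      by_cases hk' : k + 1 < α
      · rw [extendSeq_apply S hk']
        exact ⟨_, hS.final ⟨k, hk⟩ ⟨k + 1, hk'⟩ rfl
          (inter_accept_nonempty.2 ((last_mem_image (hn := hn)).1 hl)), rfl⟩
      · simp only [extendSeq, hk', dif_neg, not_false_eq_true]
        exact ⟨rfl, ⟨k, hk⟩, rfl, hl⟩
    · simp only [extendSeq, hk, dif_neg, not_false_eq_true] at h
      have := three_le_extendSize hn k
      have := h.1
      omega

theorem exists_word_reached_eq (hα : 0 < α) {S : (k : Fin α) → Set (Fin (n k))}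
    (hS : IsValid (witness hn) S) : ∃ w, reached (witness hn) w = S := by
  have hr := reaches_of_validSeq (three_le_extendSize hn) α _ (validSeq_extendSeq hα hS)
    fun j hj => extendSeq_eq_empty S hj
  obtain ⟨-, w, hw⟩ := exists_word_of_reaches (α := α) (three_le_extendSize hn) hr
  refine ⟨w, ?_⟩
  funext k
  ext q
  rw [mem_reached_iff, hw k k.2, extendSeq_apply S k.2]
  exact Fin.val_injective.mem_set_image

theorem exists_distinguishing_word (hα : 0 < α) {v w : List (Fin (α + 1))} {k : Fin α}
    {q : Fin (n k)} (hv : q ∈ reached (witness hn) v k) (hw : q ∉ reached (witness hn) w k) :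
    ∃ u, v ++ u ∈ catenation (fun k => (witness hn k).accepts) ∧
      w ++ u ∉ catenation (fun k => (witness hn k).accepts) := by
  rw [mem_reached_iff] at hv hw
  obtain ⟨u, hu, h1, h2⟩ := exists_distinguishing (three_le_extendSize hn) (α := α)
    (α - 1 - k) k q _ _ (by omega) ((extendSize_apply k).symm ▸ q.2) hv hw
  obtain ⟨u, rfl⟩ := exists_map_val u hu
  rw [← subsetEval_append, ← List.map_append] at h1 h2
  have key : ∀ x : List (Fin (α + 1)), x ∈ catenation (fun k => (witness hn k).accepts) ↔
      extendSize n (α - 1) - 1 ∈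
        subsetEval (extendSize n) initialSeq (x.map Fin.val) (α - 1) := by
    intro x
    rw [mem_catenation_iff hα, inter_accept_nonempty, mem_reached_iff,
      show extendSize n (α - 1) = n ⟨α - 1, by omega⟩ from extendSize_apply ⟨α - 1, by omega⟩]
    rfl
  exact ⟨u, (key _).2 h1, mt (key _).1 h2⟩

theorem ncard_isValid_witness_le (hα : 0 < α) {m : ℕ} (M : DFA (Fin (α + 1)) (Fin m))
    (hM : M.accepts = catenation fun k => (witness hn k).accepts) :
    {S : (k : Fin α) → Set (Fin (n k)) | IsValid (witness hn) S}.ncard ≤ m := by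
  -- Words reaching different valid sequences must lead to different states of `M`.
  choose w hw using fun S : {S : (k : Fin α) → Set (Fin (n k)) | IsValid (witness hn) S} =>
    exists_word_reached_eq hα S.2
  have hsub : ∀ S T, M.eval (w S) = M.eval (w T) → ∀ k, S.1 k ⊆ T.1 k := by
    intro S T h k q hq
    by_contra hq'
    rw [← hw S] at hq
    rw [← hw T] at hq'
    obtain ⟨u, h1, h2⟩ := exists_distinguishing_word hα hq hq'
    rw [← hM, DFA.mem_accepts, DFA.eval, DFA.evalFrom_of_append] at h1 h2
    apply h2
    change M.evalFrom (M.eval (w T)) u ∈ _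
    rw [← h]
    exact h1
  have hinj : Function.Injective fun S => M.eval (w S) := by
    intro S T h
    apply Subtype.ext
    funext k
    exact (hsub S T h k).antisymm (hsub T S h.symm k)
  simpa [Set.ncard] using Nat.card_le_card_of_injective _ hinj

/-! ### Minimality of the witnesses and conclusion -/

theorem cycle_apply {m t : ℕ} (h : t + 1 < m) :
    cycle m ⟨t, by omega⟩ = ⟨t + 1, h⟩ := by
  obtain ⟨m, rfl⟩ : ∃ l, m = l + 1 := ⟨m - 1, by omega⟩
  have hne : (⟨t, by omega⟩ : Fin (m + 1)) ≠ Fin.last m := by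
    simp only [ne_eq, Fin.ext_iff, Fin.val_last]
    omega
  exact Fin.ext (coe_finRotate_of_ne_last hne)

theorem eval_witness_replicate (k : Fin α) (t : ℕ) (ht : t < n k) :
    (witness hn k).eval (List.replicate t ⟨k + 1, by omega⟩) = ⟨t, ht⟩ := by
  induction t with
  | zero => rfl
  | succ t ih =>
    rw [List.replicate_succ', DFA.eval_append_singleton, ih (by omega)]
    simp only [witness, witnessDFA, show ¬ ((k : ℕ) + 1 + 1 = k) by omega,
      show ¬ ((k : ℕ) + 1 = k) by omega, if_false, if_true]
    exact cycle_apply ht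

/-- Among the powers of the cycle letter with exponent below `n k`, only the exponent `n k - 1` is
accepted; appending a suitable power therefore separates any two of them. -/
theorem isMinimalDFA_witness (k : Fin α) : IsMinimalDFA (witness hn k) := by
  intro m M hM
  have hk := hn k
  let c : Fin (α + 1) := ⟨k + 1, by omega⟩
  have hacc : ∀ t, t < n k → (List.replicate t c ∈ M.accepts ↔ t = n k - 1) := by
    intro t ht
    rw [hM, DFA.mem_accepts, eval_witness_replicate k t ht, accept_witness,
      Set.mem_singleton_iff, lastState, Fin.mk.injEq]
  have hne : ∀ i j : ℕ, i < j → j < n k →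
      M.eval (List.replicate i c) ≠ M.eval (List.replicate j c) := by
    intro i j hij hj h
    have h1 := (hacc (j + (n k - 1 - j)) (by omega)).2 (by omega)
    have h2 : List.replicate (i + (n k - 1 - j)) c ∈ M.accepts := by
      rw [List.replicate_add, DFA.mem_accepts, DFA.eval, DFA.evalFrom_of_append] at h1 ⊢
      change M.evalFrom (M.eval (List.replicate i c)) _ ∈ _
      rw [h]
      exact h1
    have := (hacc _ (by omega)).1 h2
    omega
  have hinj : Function.Injective fun i : Fin (n k) => M.eval (List.replicate i c) := by
    intro i j h
    rcases lt_trichotomy i j with hij | hij | hij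
    · exact absurd h (hne i j hij j.2)
    · exact hij
    · exact absurd h.symm (hne j i hij i.2)
  simpa using Fintype.card_le_of_injective _ hinj

theorem isRegular_and_stateComplexity_witness (k : Fin α) :
    (witness hn k).accepts.IsRegular ∧ stateComplexity (witness hn k).accepts = n k := by
  have hreg : (witness hn k).accepts.IsRegular := ⟨_, inferInstance, witness hn k, rfl⟩
  obtain ⟨M, hM⟩ := exists_dfa_of_isRegular hreg
  exact ⟨hreg, (stateComplexity_le _ rfl).antisymm (isMinimalDFA_witness k _ M hM)⟩

theorem stateComplexity_catenation_witness (hα : 0 < α) :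
    stateComplexity (catenation fun k => (witness hn k).accepts) =
      {S : (k : Fin α) → Set (Fin (n k)) | IsValid (witness hn) S}.ncard := by
  obtain ⟨m, -, M, hM⟩ := exists_dfa_catenation (B := witness hn) hα
  -- Regularity of the catenation ensures that the infimum in `stateComplexity` is attained, rather
  -- than being the default `0` of an empty set.
  obtain ⟨M', hM'⟩ := exists_dfa_of_isRegular ⟨_, inferInstance, M, hM⟩
  exact (stateComplexity_catenation_le hα).antisymm (ncard_isValid_witness_le hα M' hM')

theorem accept_nonempty_of_one_lt {Γ : Type*} {m : ℕ} (M : DFA Γ (Fin m))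
    (h : 1 < stateComplexity M.accepts) : M.accept.Nonempty := by
  by_contra hne
  rw [Set.not_nonempty_iff_eq_empty] at hne
  let M' : DFA Γ (Fin 1) := ⟨fun q _ => q, 0, ∅⟩
  have : M'.accepts = M.accepts := by
    ext w
    rw [DFA.mem_accepts, DFA.mem_accepts, hne]
    rfl
  exact absurd (stateComplexity_le M' this) (not_le.2 h)

theorem stateComplexity_catenation_le_witness (hα : 0 < α) {Γ : Type*}
    (K : Fin α → Language Γ) (hK : ∀ k, (K k).IsRegular ∧ stateComplexity (K k) = n k) :
    stateComplexity (catenation K) ≤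
      stateComplexity (catenation fun k => (witness hn k).accepts) := by
  have hB : ∀ k, ∃ M : DFA Γ (Fin (n k)), M.accepts = K k := by
    intro k
    rw [← (hK k).2]
    exact exists_dfa_of_isRegular (hK k).1
  choose B hB using hB
  obtain rfl : (fun k => (B k).accepts) = K := funext hB
  rw [stateComplexity_catenation_witness hα]
  refine (stateComplexity_catenation_le hα).trans
    (ncard_isValid_le _ (lastState hn) accept_witness start_ne_lastState B fun k => ?_)
  -- An automaton without final states accepts the empty language, of complexity at most `1`,
  -- whereas `n k ≥ 3`.
  apply accept_nonempty_of_one_lt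
  have := hn k
  have := (hK k).2
  simp only at this
  omega

end Witness

end MultiCatenation

theorem mainTheorem1 (α : ℕ) (hα : 0 < α) (n : Fin α → ℕ) (hn : ∀ k, 3 ≤ n k)
    (A : (k : Fin α) → DFA (Fin (α + 1)) (Fin (n k)))
    (hA : ∀ k, A k = MultiCatenation.witnessDFA k (n k) (le_trans (by norm_num) (hn k))) :
    (∀ k, MultiCatenation.IsMinimalDFA (A k)) ∧
    MultiCatenation.IsCatenationWitness n (fun k => (A k).accepts) ∧
    MultiCatenation.stateComplexity (MultiCatenation.catenation fun k => (A k).accepts) =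
      {S : (k : Fin α) → Set (Fin (n k)) | MultiCatenation.IsValid A S}.ncard := by
  obtain rfl : A = MultiCatenation.witness hn := funext hA
  refine ⟨MultiCatenation.isMinimalDFA_witness,
    ⟨MultiCatenation.isRegular_and_stateComplexity_witness, ⟨?_, ?_⟩⟩,
    MultiCatenation.stateComplexity_catenation_witness hα⟩
  · exact ⟨Fin (α + 1), inferInstance, _,
      MultiCatenation.isRegular_and_stateComplexity_witness, rfl⟩
  · rintro _ ⟨Γ, -, K, hK, rfl⟩
    exact MultiCatenation.stateComplexity_catenation_le_witness hα K hK
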